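/- **Notation.** For $k\in\mathbb Z^d$ write $k\triangleright 0$ if $k\neq 0$ and the first nonzero entry of $k$ is positive. Let $\mathcal C,\mathcal S:\mathbb R\to\mathbb R$ be the 1-periodic functions with $\mathcal C(x)=4|x-\tfrac12|-1$ and $\mathcal S(x)=\bigl|2-4|x-\tfrac14|\bigr|-1$ for $x\in[0,1)$, and put $\mathcal C_k(x)=\mathcal C(k\cdot x)$, $\mathcal S_k(x)=\mathcal S(k\cdot x)$ for $x\in\mathbb R^d$. A real-valued function $f$ on $[0,1]^d$ belongs to $\mathbb B^s([0,1]^d)$ if $f(x)=\sum_{m\in\mathbb Z^d}a_m e^{2\pi i m\cdot x}$ (a.e. on $[0,1]^d$), with complex coefficients such that $\|f\|_{\mathbb B^s}:=|a_0|+\sum_{m\ne0}\|m\|_2^s|a_m|<\infty$. For a sequence $\alpha=(\alpha_k)_{k\triangleright 0}$ let $\|\alpha\|_{b_s^d}=\sum_{k\triangleright0}\|k\|_2^s|\alpha_k|$, let $\sigma_n(\alpha)$ be the infimum of $\|\alpha-\sum_{j=1}^n c_je_{k_j}\|_{\ell_2}$ over all scalars $c_j$ and all canonical sequences $e_{k_j}$,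 and let $\sigma_n(b_s^d,\ell_2)=\sup\{\sigma_n(\alpha):\|\alpha\|_{b_s^d}\le1\}$. A linear combination of $n$ canonical sequences that attains $\sigma_n(\alpha)$ is called a best $n$-term approximation of $\alpha$. For $R>0$ let $\alpha^R$ be the truncation of $\alpha$: $\alpha^R_k=\alpha_k$ if $\|k\|_2\le R$ and $\alpha_k^R=0$ otherwise. For positive integers $d,W,L$ let $\Upsilon_d^{W,L}$ be the set of ReLU networks $A^{(L)}\circ\mathrm{ReLU}\circ A^{(L-1)}\circ\cdots\circ\mathrm{ReLU}\circ A^{(0)}$ with affine maps $A^{(0)}:\mathbb R^d\to\mathbb R^W$, $A^{(j)}:\mathbb R^W\to\mathbb R^W$ for $1\le j\le L-1$, and $A^{(L)}:\mathbb R^W\to\mathbb R$. **Theorem.** Let $0<s<1$. There are constants $c,C>0$, depending only on $s$, such that the following holds for every integer $d\ge1$ and every $0<\varepsilon<1$. Let $R:=(C/\varepsilon)^{1/s}$ and let $n\ge1$ be an integer with $\sigma_n(b_s^d,\ell_2)<c\,\varepsilon$. Then there is an integer $L$ with $$1\le L\le 4+\log_2\bigl(R\sqrt{\min(R,d)}\bigr)$$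 and a map that assigns to each $(\alpha_0,\alpha',\beta')$, where $\alpha_0\in\mathbb R$ and $\alpha',\beta'$ are real sequences indexed by $k\triangleright0$, a network $\mathcal N_{\alpha_0,\alpha',\beta'}\in\Upsilon_d^{4n,L}$, such that for every real-valued $f\in\mathbb B^s([0,1]^d)$ the following is true. The function $f$ has an expansion $$f=\alpha_0+\sum_{k\triangleright0}\bigl[\alpha_k\mathcal C_k+\beta_k\mathcal S_k\bigr]\quad\text{in }L_2([0,1]^d)$$ with real coefficients; $\alpha^R$ and $\beta^R$ have best $n$-term approximations in $\ell_2$; and for any such best $n$-term approximations $\alpha'$ of $\alpha^R$ and $\beta'$ of $\beta^R$, the network $\mathcal N=\mathcal N_{\alpha_0,\alpha',\beta'}$ satisfies $$\|f-\mathcal N\|_{L_2([0,1]^d)}\le\varepsilon\,\|f\|_{\mathbb B^s}.$$ Moreover, $\mathcal N$ is explicit in the coefficients of the best $n$-term approximations: there are finite sets $I\subseteq\operatorname{supp}\alpha'$ and $J\subseteq\operatorname{supp}\beta'$ with $$\mathcal N(x)=\alpha_0+\sum_{k\in I}\alpha'_k\,\mathcal C_k(x)+\sum_{k\in J}\beta'_k\,\mathcal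 S_k(x)\qquad\text{for all }x\in[0,1]^d,$$ and $I=\operatorname{supp}\alpha'$, $J=\operatorname{supp}\beta'$ whenever $\|k\|_1\le R\sqrt{\min(R,d)}$ for all $k\in\operatorname{supp}\alpha'\cup\operatorname{supp}\beta'$ (in particular, whenever $d\le R$). -/

import Mathlib

open MeasureTheory Filter Topology
open scoped ENNReal

namespace BarronANN

noncomputable section

/-- The unit cube `[0,1]^d`. -/
def cube (d : ℕ) : Set (Fin d → ℝ) := Set.Icc 0 1

/-- The inner product `k · x = ∑ j, k_j x_j`. -/
def freqDot {d : ℕ} (k : Fin d → ℤ) (x : Fin d → ℝ) : ℝ := ∑ j, (k j : ℝ) * x j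

/-- The Euclidean norm of an integer vector. -/
def norm2 {d : ℕ} (k : Fin d → ℤ) : ℝ := Real.sqrt (∑ j, (k j : ℝ) ^ 2)

/-- The `ℓ₁`-norm of an integer vector. -/
def norm1 {d : ℕ} (k : Fin d → ℤ) : ℝ := ∑ j, |(k j : ℝ)|

/-- The frequencies `k ∈ ℤ^d` that are nonzero and have a positive first nonzero entry. -/
abbrev PosFreq (d : ℕ) : Type :=
  {k : Fin d → ℤ // ∃ j, (∀ i, i < j → k i = 0) ∧ 0 < k j}

/-! ### The piecewise linear system -/

/-- The 1-periodic piecewise linear cosine: `4 |x - 1/2| - 1` on `[0,1)`. -/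
def plCos (x : ℝ) : ℝ := 4 * |Int.fract x - 1 / 2| - 1

/-- The 1-periodic piecewise linear sine: `|2 - 4 |x - 1/4|| - 1` on `[0,1)`. -/
def plSin (x : ℝ) : ℝ := abs (2 - 4 * |Int.fract x - 1 / 4|) - 1

/-- `𝒞_k(x) = 𝒞(k · x)`. -/
def plCosAt {d : ℕ} (k : Fin d → ℤ) (x : Fin d → ℝ) : ℝ := plCos (freqDot k x)

/-- `𝒮_k(x) = 𝒮(k · x)`. -/
def plSinAt {d : ℕ} (k : Fin d → ℤ) (x : Fin d → ℝ) : ℝ := plSin (freqDot k x)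

/-- `f = α₀ + ∑_k (α_k 𝒞_k + β_k 𝒮_k)` with convergence in `L₂([0,1]^d)`. -/
def HasPLSeries {d : ℕ} (f : (Fin d → ℝ) → ℝ) (α₀ : ℝ) (α β : PosFreq d → ℝ) : Prop :=
  Tendsto
    (fun F : Finset (PosFreq d) =>
      eLpNorm (fun x => f x - (α₀ + ∑ k ∈ F, (α k * plCosAt k.1 x + β k * plSinAt k.1 x)))
        2 (volume.restrict (cube d)))
    atTop (𝓝 0)

/-! ### Barron classes -/

/-- `f(x) = ∑_m a_m exp(2πi m · x)` for almost all `x ∈ [0,1]^d`. -/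
def HasFourierSeries {d : ℕ} (f : (Fin d → ℝ) → ℝ) (a : (Fin d → ℤ) → ℂ) : Prop :=
  ∀ᵐ x ∂(volume.restrict (cube d)),
    HasSum (fun m : Fin d → ℤ =>
      a m * Complex.exp (2 * (Real.pi : ℂ) * Complex.I * ((freqDot m x : ℝ) : ℂ))) ((f x : ℝ) : ℂ)

/-- The Barron norm of the function with Fourier coefficients `a`. -/
def barronNorm {d : ℕ} (s : ℝ) (a : (Fin d → ℤ) → ℂ) : ℝ≥0∞ :=
  ‖a 0‖ₑ + ∑' m : {m : Fin d → ℤ // m ≠ 0}, ENNReal.ofReal (norm2 m.1 ^ s) * ‖a m.1‖ₑ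

/-- `f ∈ 𝔹^s([0,1]^d)`, with Fourier coefficients `a`. As the series converges absolutely, `a` is
determined by `f`, and `barronNorm s a` is the norm of `f`. -/
def IsBarron {d : ℕ} (s : ℝ) (f : (Fin d → ℝ) → ℝ) (a : (Fin d → ℤ) → ℂ) : Prop :=
  HasFourierSeries f a ∧ barronNorm s a < ∞

/-! ### Best n-term approximation of sequences -/

/-- The `ℓ₂`-norm of a sequence. -/
def ell2Norm {ι 𝕜 : Type} [NormedField 𝕜] (α : ι → 𝕜) : ℝ≥0∞ :=
  (∑' k, ‖α k‖ₑ ^ 2) ^ (1 / 2 : ℝ)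

/-- The linear combination `∑_{j=1}^n c_j e_{κ_j}` of canonical sequences. -/
def nTerm {ι 𝕜 : Type} [DecidableEq ι] [NormedField 𝕜] {n : ℕ} (c : Fin n → 𝕜) (κ : Fin n → ι) :
    ι → 𝕜 :=
  ∑ j, Pi.single (κ j) (c j)

/-- The error `σ_n(α)` of best `n`-term approximation of the sequence `α` in `ℓ₂`. -/
def nTermError {ι 𝕜 : Type} [DecidableEq ι] [NormedField 𝕜] (n : ℕ) (α : ι → 𝕜) : ℝ≥0∞ :=
  ⨅ (c : Fin n → 𝕜) (κ : Fin n → ι), ell2Norm (α - nTerm c κ)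

/-- `a` is a best `n`-term approximation of `α` in `ℓ₂`. -/
def IsBestNTerm {ι 𝕜 : Type} [DecidableEq ι] [NormedField 𝕜] (n : ℕ) (α a : ι → 𝕜) : Prop :=
  (∃ (c : Fin n → 𝕜) (κ : Fin n → ι), a = nTerm c κ) ∧ ell2Norm (α - a) = nTermError n α

/-- The norm of the weighted sequence space `b_s^d`. -/
def bNorm {d : ℕ} (s : ℝ) (α : PosFreq d → ℂ) : ℝ≥0∞ :=
  ∑' k : PosFreq d, ENNReal.ofReal (norm2 k.1 ^ s) * ‖α k‖ₑ

/-- The width `σ_n(b_s^d, ℓ₂)`: the worst error of best `n`-term approximation in `ℓ₂` over the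
unit ball of `b_s^d`. -/
def sigmaN (d : ℕ) (s : ℝ) (n : ℕ) : ℝ≥0∞ :=
  ⨆ (α : PosFreq d → ℂ) (_ : bNorm s α ≤ 1), nTermError n α

/-- The truncation `α^R`, which keeps the entries with `‖k‖₂ ≤ R` and sets the others to zero. -/
def truncate {d : ℕ} (R : ℝ) (α : PosFreq d → ℝ) : PosFreq d → ℝ :=
  Set.indicator {k | norm2 k.1 ≤ R} α

/-! ### ReLU networks -/

/-- The ReLU activation function, applied coordinatewise. -/
def relu {W : ℕ} (v : Fin W → ℝ) : Fin W → ℝ := fun i => max (v i) 0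

/-- A feed-forward network on `ℝ^d` of width `W` and depth `L ≥ 1` (the number of hidden layers):
affine maps `A⁽⁰⁾, …, A⁽ᴸ⁾`, of which `A⁽¹⁾, …, A⁽ᴸ⁻¹⁾` are the field `hidden`. -/
structure ReLUNet (d W L : ℕ) where
  input : (Fin d → ℝ) →ᵃ[ℝ] (Fin W → ℝ)
  hidden : Fin (L - 1) → ((Fin W → ℝ) →ᵃ[ℝ] (Fin W → ℝ))
  output : (Fin W → ℝ) →ᵃ[ℝ] ℝ

/-- The function `A⁽ᴸ⁾ ∘ ReLU ∘ A⁽ᴸ⁻¹⁾ ∘ ⋯ ∘ ReLU ∘ A⁽⁰⁾` generated by a network. -/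
def ReLUNet.eval {d W L : ℕ} (N : ReLUNet d W L) (x : Fin d → ℝ) : ℝ :=
  N.output (Fin.foldl (L - 1) (fun v j => relu (N.hidden j v)) (relu (N.input x)))

end

end BarronANN

open BarronANN

namespace BarronANN

noncomputable section

/-! ### The piecewise linear cosine -/

/-! The piecewise linear waves replace sines and cosines at bounded cost. The Fourier series of
`plCos` and `plSin` have coefficients χ(n)/n² with χ completely multiplicative, so Möbius inversion
writes cos and sin as series in the dilates `plCos (m t)`, `plSin (m t)` with coefficients O(m⁻²).
Since ‖mk‖^s = m^s ‖k‖^s and s < 1, Barron coefficients turn into piecewise linear coefficients with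
comparable weighted ℓ₁-norm (`exists_basis_change`). Conversely, `plCos` is a convex combination of
dilated cosines, so the L₂-norm of a piecewise linear sum is at most the ℓ₂-norm of its coefficients
(`eLpNorm_sum_plCos_le`). The error analysis thus takes place in ℓ₂: truncation at R costs R^(-s),
best n-term approximation costs σ_n, each times the weighted norm.

On [0,1] iterated tent maps are exactly dilates of `plCos`, and a tent is two ReLU units. A wave of
frequency k is therefore a chain of width 2 whose depth is about log₂ ‖k‖₁, and 2n chains in
parallel have width 4n.

The depth allows ‖k‖₁ ≤ R√(min(R,d)). If d ≤ R this always holds, by Cauchy–Schwarz. If d > R,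
integrality only gives ‖k‖₁ ≤ R². In that case a flat sequence on short frequencies bounds σ_n below
by a multiple of n^(-1/2) (`ofReal_le_sigmaN`), so the assumption on σ_n forces n to be at least of
order R^(2s). Keeping only about half of the terms then loses another O(R^(-s)) in ℓ₂
(`exists_subset_sum_sq_le`), and the freed neurons let each remaining chain perform two tents per
layer, which squares the admissible frequency at the same depth. -/

lemma plCos_add_int (t : ℝ) (z : ℤ) : plCos (t + z) = plCos t := by
  simp [plCos]

lemma plCos_neg (t : ℝ) : plCos (-t) = plCos t := by
  unfold plCos
  by_cases h : Int.fract t = 0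
  · have h' : Int.fract (-t) = 0 := Int.fract_neg_eq_zero.mpr h
    rw [h, h']
  · rw [Int.fract_neg h, show (1 - Int.fract t - 1 / 2 : ℝ) = -(Int.fract t - 1 / 2) by ring, abs_neg]

/-- A phase shift is all that separates the two waves, so networks and L₂-bounds need only be built
for `plCos` with a phase. -/
lemma plSin_eq_plCos (t : ℝ) : plSin t = plCos (t + 3 / 4) := by
  have h0 := Int.fract_nonneg t
  have h1 := Int.fract_lt_one t
  have ht : t = Int.fract t + (⌊t⌋ : ℤ) := (Int.fract_add_floor t).symm
  unfold plSin plCos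
  have h2 : Int.fract (t + 3 / 4) = Int.fract (Int.fract t + 3 / 4) := by
    conv_lhs => rw [ht, add_right_comm]
    exact Int.fract_add_intCast _ _
  rw [h2]
  generalize Int.fract t = y at *
  by_cases hy : y < 1 / 4
  · rw [Int.fract_eq_self.mpr ⟨by linarith, by linarith⟩, abs_of_neg (show y - 1 / 4 < 0 by linarith),
      abs_of_nonneg (by linarith), abs_of_nonneg (by linarith)]
    ring
  · have h3 : Int.fract (y + 3 / 4) = y - 1 / 4 := by
      rw [show y + 3 / 4 = (y - 1 / 4) + (1 : ℤ) by push_cast; ring, Int.fract_add_intCast]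
      exact Int.fract_eq_self.mpr ⟨by linarith, by linarith⟩
    rw [h3, abs_of_nonneg (show 0 ≤ y - 1 / 4 by linarith),
      show (2 - 4 * (y - 1 / 4)) = -(4 * (y - 1 / 4 - 1 / 2)) by ring, abs_neg, abs_mul]
    norm_num

lemma plCos_of_mem_Icc {y : ℝ} (h0 : 0 ≤ y) (h1 : y ≤ 1) : plCos y = 4 * |y - 1 / 2| - 1 := by
  rcases h1.eq_or_lt with rfl | h
  · norm_num [plCos]
  · rw [plCos, Int.fract_eq_self.mpr ⟨h0, h⟩]

lemma abs_plCos_le (t : ℝ) : |plCos t| ≤ 1 := by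
  have h0 := Int.fract_nonneg t
  have h1 := Int.fract_lt_one t
  have h2 : |Int.fract t - 1 / 2| ≤ 1 / 2 := abs_le.mpr ⟨by linarith, by linarith⟩
  have h3 := abs_nonneg (Int.fract t - 1 / 2)
  unfold plCos
  exact abs_le.mpr ⟨by linarith, by linarith⟩

/-! ### One-dimensional ReLU layers -/

/-- The piecewise linear function `∑ i, a i * max (y - b i) 0`. -/
def reluSum {w : ℕ} (a b : Fin w → ℝ) (y : ℝ) : ℝ := ∑ i, a i * max (y - b i) 0

/-- The tent map as a sum of two ReLU units. -/
def tent : ℝ → ℝ := reluSum ![2, -4] ![0, 1 / 2]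

/-- The twofold tent map as a sum of four ReLU units. -/
def doubleTent : ℝ → ℝ := reluSum ![4, -8, 8, -8] ![0, 1 / 4, 1 / 2, 3 / 4]

lemma tent_of_le {y : ℝ} (h0 : 0 ≤ y) (h1 : y ≤ 1 / 2) : tent y = 2 * y := by
  simp only [tent, reluSum, Fin.sum_univ_two, Matrix.cons_val_zero, Matrix.cons_val_one]
  rw [max_eq_left (by linarith), max_eq_right (by linarith)]
  ring

lemma tent_of_ge {y : ℝ} (h0 : 1 / 2 ≤ y) : tent y = 2 - 2 * y := by
  simp only [tent, reluSum, Fin.sum_univ_two, Matrix.cons_val_zero, Matrix.cons_val_one]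
  rw [max_eq_left (by linarith), max_eq_left (by linarith)]
  ring

lemma tent_mem {y : ℝ} (hy : y ∈ Set.Icc (0 : ℝ) 1) : tent y ∈ Set.Icc (0 : ℝ) 1 := by
  obtain ⟨h0, h1⟩ := hy
  rcases le_total y (1 / 2) with h | h
  · rw [tent_of_le h0 h]; constructor <;> linarith
  · rw [tent_of_ge h]; constructor <;> linarith

lemma doubleTent_eq {y : ℝ} (hy : y ∈ Set.Icc (0 : ℝ) 1) : doubleTent y = tent (tent y) := by
  obtain ⟨h0, h1⟩ := hy
  have hd : doubleTent y = 4 * max y 0 - 8 * max (y - 1 / 4) 0 + 8 * max (y - 1 / 2) 0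
      - 8 * max (y - 3 / 4) 0 := by
    simp [doubleTent, reluSum, Fin.sum_univ_four]
    ring
  rw [hd, max_eq_left h0]
  rcases le_total y (1 / 2) with h | h
  · rw [tent_of_le h0 h, max_eq_right (show y - 1 / 2 ≤ 0 by linarith),
      max_eq_right (show y - 3 / 4 ≤ 0 by linarith)]
    rcases le_total y (1 / 4) with h' | h'
    · rw [max_eq_right (by linarith), tent_of_le (by linarith) (by linarith)]; ring
    · rw [max_eq_left (by linarith), tent_of_ge (by linarith)]; ring
  · rw [tent_of_ge h, max_eq_left (show 0 ≤ y - 1 / 2 by linarith),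
      max_eq_left (show 0 ≤ y - 1 / 4 by linarith)]
    rcases le_total y (3 / 4) with h' | h'
    · rw [max_eq_right (by linarith), tent_of_ge (by linarith)]; ring
    · rw [max_eq_left (by linarith), tent_of_le (by linarith) (by linarith)]; ring

/-- Folding by one tent doubles the frequency: 2^j · tent y is 2^(j+1) y up to sign and an integer,
and `plCos` is even and periodic. The first tent only produces frequency 1, hence j + 1 iterates for
2^j. -/
lemma tent_iterate_succ (j : ℕ) {y : ℝ} (hy : y ∈ Set.Icc (0 : ℝ) 1) :
    1 - 2 * tent^[j + 1] y = plCos (2 ^ j * y) := by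
  induction j generalizing y with
  | zero =>
    obtain ⟨h0, h1⟩ := hy
    rw [pow_zero, one_mul, plCos_of_mem_Icc h0 h1, zero_add, Function.iterate_one]
    rcases le_total y (1 / 2) with h | h
    · rw [tent_of_le h0 h, abs_of_nonpos (by linarith)]; ring
    · rw [tent_of_ge h, abs_of_nonneg (by linarith)]; ring
  | succ j ih =>
    rw [Function.iterate_succ_apply, ih (tent_mem hy)]
    rcases le_total y (1 / 2) with h | h
    · rw [tent_of_le hy.1 h]; congr 1; ring
    · rw [tent_of_ge h, ← plCos_neg (2 ^ (j + 1) * y),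
        ← plCos_add_int (-(2 ^ (j + 1) * y)) (2 ^ (j + 1))]
      congr 1; push_cast; ring

lemma doubleTent_iterate (j : ℕ) {y : ℝ} (hy : y ∈ Set.Icc (0 : ℝ) 1) :
    doubleTent^[j] y = tent^[2 * j] y := by
  induction j generalizing y with
  | zero => rfl
  | succ j ih =>
    rw [Function.iterate_succ_apply, doubleTent_eq hy, ih (tent_mem (tent_mem hy)), mul_add, mul_one,
      Function.iterate_add_apply]
    rfl

/-! ### Parallel composition of one-dimensional layers -/

/-- After each ReLU the neurons of chain p store max(y_p - b_i, 0). One fixed affine map recombines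
them into the next y_p and subtracts the b_i again, so all hidden maps coincide. -/
lemma exists_reluNet_iterate {d W w L : ℕ} {ι : Type} [Fintype ι] (hL : 1 ≤ L)
    (e : ι × Fin w ≃ Fin W) (a b : Fin w → ℝ) (u : ι → (Fin d → ℝ) →ᵃ[ℝ] ℝ) (γ₀ : ℝ) (γ : ι → ℝ) :
    ∃ N : ReLUNet d W L, ∀ x, N.eval x = γ₀ + ∑ p, γ p * (reluSum a b)^[L] (u p x) := by
  let A : (Fin W → ℝ) →ᵃ[ℝ] (Fin W → ℝ) := AffineMap.pi fun q =>
    (∑ i, a i • (LinearMap.proj (e ((e.symm q).1, i)) : (Fin W → ℝ) →ₗ[ℝ] ℝ)).toAffineMap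
      + AffineMap.const ℝ _ (-b (e.symm q).2)
  let state : (ι → ℝ) → Fin W → ℝ := fun y => relu fun q => y (e.symm q).1 - b (e.symm q).2
  have hstate : ∀ y p i, state y (e (p, i)) = max (y p - b i) 0 := by
    intro y p i; simp [state, relu]
  have hA : ∀ y, relu (A (state y)) = state fun p => reluSum a b (y p) := by
    intro y
    funext q
    simp [A, relu, state, reluSum, sub_eq_add_neg]
  have hfold : ∀ m y, Fin.foldl m (fun v (_ : Fin m) => relu (A v)) (state y)
      = state fun p => (reluSum a b)^[m] (y p) := by
    intro m
    induction m with
    | zero => intro y; simp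
    | succ m ih => intro y; rw [Fin.foldl_succ]; simp only [hA, ih, Function.iterate_succ_apply]
  refine ⟨⟨AffineMap.pi fun q => u (e.symm q).1 - AffineMap.const ℝ _ (b (e.symm q).2),
    fun _ => A,
    (∑ p, γ p • ∑ i, a i • (LinearMap.proj (e (p, i)) : (Fin W → ℝ) →ₗ[ℝ] ℝ)).toAffineMap
      + AffineMap.const ℝ _ γ₀⟩, fun x => ?_⟩
  have hin : relu ((AffineMap.pi fun q => u (e.symm q).1 - AffineMap.const ℝ _ (b (e.symm q).2) :
      (Fin d → ℝ) →ᵃ[ℝ] (Fin W → ℝ)) x) = state fun p => u p x := by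
    funext q; simp [relu, state]
  -- The L - 1 hidden maps give L - 1 iterates; the output map carries out the last one.
  obtain ⟨m, rfl⟩ : ∃ m, L = m + 1 := ⟨L - 1, by omega⟩
  simp only [ReLUNet.eval]
  rw [hin]
  rw [hfold (m + 1 - 1) fun p => u p x]
  simp [hstate, add_comm, Function.iterate_succ_apply', reluSum]

/-- Pads a set to exactly n slots, with χ = 0 on the dummy slots. It serves both for chains in a
network of fixed width and for n-term sums of canonical sequences. -/
lemma exists_fin_enumeration {ι : Type} [Nonempty ι] (I : Finset ι) {n : ℕ} (h : I.card ≤ n) :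
    ∃ (κ : Fin n → ι) (χ : Fin n → ℝ), (∀ p, χ p = 0 ∨ κ p ∈ I) ∧
      ∀ {M : Type} [AddCommGroup M] [Module ℝ M] (F : ι → M),
        ∑ k ∈ I, F k = ∑ p, χ p • F (κ p) := by
  classical
  induction I using Finset.induction_on generalizing n with
  | empty => exact ⟨fun _ => Classical.arbitrary ι, 0, by simp, by simp⟩
  | insert k I hk ih =>
    rw [Finset.card_insert_of_notMem hk] at h
    obtain ⟨n, rfl⟩ : ∃ m, n = m + 1 := ⟨n - 1, by omega⟩
    obtain ⟨κ, χ, h1, h2⟩ := ih (n := n) (by omega)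
    refine ⟨Fin.cons k κ, Fin.cons 1 χ, fun p => ?_, fun F => ?_⟩
    · refine Fin.cases (by simp) (fun p => ?_) p
      rcases h1 p with h | h <;> simp [h]
    · rw [Finset.sum_insert hk, Fin.sum_univ_succ, h2]
      simp

/-! ### Networks for finite combinations of the piecewise linear system -/

/-- Tent iterates are waves only on [0,1]. Adding the integer z = -min k·x over the cube does not
change `plCos` and moves k·x into [0, ‖k‖₁]; the extra 1 leaves room for the phase θ. -/
lemma exists_affine_mem_Icc {d : ℕ} (k : Fin d → ℤ) {J : ℕ} (hk : norm1 k + 1 ≤ 2 ^ J) {θ : ℝ}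
    (hθ : θ ∈ Set.Icc (0 : ℝ) 1) :
    ∃ u : (Fin d → ℝ) →ᵃ[ℝ] ℝ, ∀ x ∈ cube d, u x ∈ Set.Icc (0 : ℝ) 1 ∧
      plCos (2 ^ J * u x) = plCos (freqDot k x + θ) := by
  let z : ℤ := ∑ j, max (-k j) 0
  refine ⟨((2 ^ J : ℝ)⁻¹ • ∑ j, (k j : ℝ) • (LinearMap.proj j : (Fin d → ℝ) →ₗ[ℝ] ℝ)).toAffineMap
    + AffineMap.const ℝ _ ((2 ^ J : ℝ)⁻¹ * (θ + z)), fun x hx => ?_⟩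
  have hu : ((((2 ^ J : ℝ)⁻¹ • ∑ j, (k j : ℝ) • (LinearMap.proj j : (Fin d → ℝ) →ₗ[ℝ] ℝ)).toAffineMap
    + AffineMap.const ℝ _ ((2 ^ J : ℝ)⁻¹ * (θ + z)) : (Fin d → ℝ) →ᵃ[ℝ] ℝ)) x = (2 ^ J : ℝ)⁻¹ * (freqDot k x + θ + z) := by
    simp [freqDot]; ring
  rw [hu]
  have hJ : (0 : ℝ) < 2 ^ J := by positivity
  have hsum : freqDot k x + z = ∑ j, ((k j : ℝ) * x j + max (-(k j : ℝ)) 0) := by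
    simp [freqDot, z, Finset.sum_add_distrib]
  have hb : ∀ j, 0 ≤ (k j : ℝ) * x j + max (-(k j : ℝ)) 0 ∧
      (k j : ℝ) * x j + max (-(k j : ℝ)) 0 ≤ |(k j : ℝ)| := by
    intro j
    have h0 : 0 ≤ x j := hx.1 j
    have h1 : x j ≤ 1 := hx.2 j
    rcases le_total 0 (k j : ℝ) with h | h
    · rw [max_eq_right (by linarith), abs_of_nonneg h]; constructor <;> nlinarith
    · rw [max_eq_left (by linarith), abs_of_nonpos h]; constructor <;> nlinarith
  have hlo : 0 ≤ freqDot k x + z := by rw [hsum]; exact Finset.sum_nonneg fun j _ => (hb j).1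
  have hhi : freqDot k x + z ≤ norm1 k := by
    rw [hsum]; exact Finset.sum_le_sum fun j _ => (hb j).2
  refine ⟨⟨mul_nonneg (by positivity) (by linarith [hθ.1]), ?_⟩, ?_⟩
  · rw [inv_mul_le_iff₀ hJ]; linarith [hθ.2]
  · rw [mul_inv_cancel_left₀ hJ.ne', plCos_add_int]

lemma exists_reluNet_plSum {d W w L M J : ℕ} (hL : 1 ≤ L) [Nonempty (PosFreq d)]
    (hW : M * w = W) (a b : Fin w → ℝ)
    (hab : ∀ y ∈ Set.Icc (0 : ℝ) 1, 1 - 2 * (reluSum a b)^[L] y = plCos (2 ^ J * y))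
    (α₀ : ℝ) (α β : PosFreq d → ℝ) (I I' : Finset (PosFreq d)) (hcard : I.card + I'.card ≤ M)
    (hI : ∀ k ∈ I, norm1 k.1 + 1 ≤ 2 ^ J) (hI' : ∀ k ∈ I', norm1 k.1 + 1 ≤ 2 ^ J) :
    ∃ N : ReLUNet d W L, ∀ x ∈ cube d, N.eval x =
      α₀ + ∑ k ∈ I, α k * plCosAt k.1 x + ∑ k ∈ I', β k * plSinAt k.1 x := by
  let freq : PosFreq d ⊕ PosFreq d → Fin d → ℤ := Sum.elim (fun k => k.1) (fun k => k.1)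
  let θ : PosFreq d ⊕ PosFreq d → ℝ := Sum.elim (fun _ => 0) (fun _ => 3 / 4)
  have hθ : ∀ p, θ p ∈ Set.Icc (0 : ℝ) 1 := by rintro (k | k) <;> norm_num [θ]
  have hu : ∀ p : PosFreq d ⊕ PosFreq d, ∃ u : (Fin d → ℝ) →ᵃ[ℝ] ℝ, p ∈ I.disjSum I' →
      ∀ x ∈ cube d, u x ∈ Set.Icc (0 : ℝ) 1 ∧
        plCos (2 ^ J * u x) = plCos (freqDot (freq p) x + θ p) := by
    intro p
    by_cases hp : p ∈ I.disjSum I'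
    · obtain ⟨u, hu⟩ := exists_affine_mem_Icc (freq p) (J := J) (by
        rcases p with k | k
        · exact hI k (by simpa using hp)
        · exact hI' k (by simpa using hp)) (hθ p)
      exact ⟨u, fun _ => hu⟩
    · exact ⟨0, fun h => absurd h hp⟩
  choose u hu using hu
  obtain ⟨κ, χ, hχ, hsum⟩ := exists_fin_enumeration (I.disjSum I') (n := M) (by simpa using hcard)
  let γ : Fin M → ℝ := fun p => χ p * Sum.elim α β (κ p)
  -- Each wave is 1 - 2 · (iterate), so its coefficient γ enters once in the constant and once as
  -- the factor -2γ.
  obtain ⟨N, hN⟩ := exists_reluNet_iterate hL (finProdFinEquiv.trans (finCongr hW)) a b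
    (fun p => u (κ p)) (α₀ + ∑ p, γ p) (fun p => -2 * γ p)
  refine ⟨N, fun x hx => ?_⟩
  have h1 : ∀ p, γ p + -2 * γ p * (reluSum a b)^[L] (u (κ p) x)
      = χ p • (Sum.elim α β (κ p) * plCos (freqDot (freq (κ p)) x + θ (κ p))) := by
    intro p
    rcases hχ p with h | h
    · simp [γ, h]
    · obtain ⟨h2, h3⟩ := hu _ h x hx
      rw [← h3, ← hab _ h2, smul_eq_mul]
      ring
  have h2 := hsum fun p => Sum.elim α β p * plCos (freqDot (freq p) x + θ p)
  rw [Finset.sum_disjSum] at h2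
  simp only [← h1, Finset.sum_add_distrib] at h2
  rw [hN, add_assoc, ← h2, add_assoc]
  simp [freq, θ, plCosAt, plSinAt, plSin_eq_plCos]

/-! ### Best n-term approximation of sequences -/

section NTerm

variable {ι : Type}

lemma ell2Norm_le_iff {𝕜 : Type} [NormedField 𝕜] {α β : ι → 𝕜} :
    ell2Norm α ≤ ell2Norm β ↔ ∑' k, ‖α k‖ₑ ^ 2 ≤ ∑' k, ‖β k‖ₑ ^ 2 :=
  ENNReal.rpow_le_rpow_iff (by norm_num)

lemma ell2Norm_sq {𝕜 : Type} [NormedField 𝕜] (α : ι → 𝕜) :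
    ell2Norm α ^ 2 = ∑' k, ‖α k‖ₑ ^ 2 := by
  rw [ell2Norm, ← ENNReal.rpow_natCast, ← ENNReal.rpow_mul]
  norm_num

lemma ell2Norm_smul {𝕜 : Type} [NormedField 𝕜] (t : 𝕜) (α : ι → 𝕜) :
    ell2Norm (t • α) = ‖t‖ₑ * ell2Norm α := by
  have h : ∀ k, ‖(t • α) k‖ₑ ^ 2 = ‖t‖ₑ ^ 2 * ‖α k‖ₑ ^ 2 := fun k => by
    rw [Pi.smul_apply, smul_eq_mul, enorm_mul, mul_pow]
  rw [ell2Norm, ell2Norm, tsum_congr h, ENNReal.tsum_mul_left,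
    ENNReal.mul_rpow_of_nonneg _ _ (by norm_num), ← ENNReal.rpow_natCast, ← ENNReal.rpow_mul]
  norm_num

variable [DecidableEq ι]

lemma nTermError_le {𝕜 : Type} [NormedField 𝕜] {n : ℕ} (α : ι → 𝕜) (c : Fin n → 𝕜)
    (κ : Fin n → ι) : nTermError n α ≤ ell2Norm (α - nTerm c κ) :=
  iInf₂_le (f := fun c κ => ell2Norm (α - nTerm c κ)) c κ

lemma le_nTermError {𝕜 : Type} [NormedField 𝕜] {n : ℕ} {α : ι → 𝕜} {t : ℝ≥0∞}
    (h : ∀ (c : Fin n → 𝕜) (κ : Fin n → ι), t ≤ ell2Norm (α - nTerm c κ)) : t ≤ nTermError n α :=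
  le_iInf₂ h

lemma nTerm_apply_eq_zero {𝕜 : Type} [NormedField 𝕜] {n : ℕ} (c : Fin n → 𝕜) (κ : Fin n → ι) {k : ι}
    (hk : k ∉ Finset.univ.image κ) : nTerm c κ k = 0 := by
  simp only [nTerm, Finset.sum_apply]
  refine Finset.sum_eq_zero fun j _ => Pi.single_eq_of_ne ?_ _
  rintro rfl
  simp at hk

lemma exists_nTerm_eq_indicator [Nonempty ι] {n : ℕ} (K : Finset ι) (hK : K.card ≤ n) (α : ι → ℝ) :
    ∃ (c : Fin n → ℝ) (κ : Fin n → ι), Set.indicator (K : Set ι) α = nTerm c κ := by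
  obtain ⟨κ, χ, -, h⟩ := exists_fin_enumeration K hK
  refine ⟨fun p => χ p * α (κ p), κ, ?_⟩
  have h1 := h fun k => Pi.single (M := fun _ => ℝ) k (α k)
  have h2 : ∑ k ∈ K, Pi.single (M := fun _ => ℝ) k (α k) = Set.indicator (K : Set ι) α := by
    funext i
    simp [Finset.sum_apply, Pi.single_apply, Set.indicator_apply]
  rw [← h2, h1, nTerm]
  refine Finset.sum_congr rfl fun p _ => ?_
  rw [← Pi.single_smul, smul_eq_mul]

lemma tsum_enorm_sq_sub_indicator (K : Finset ι) (α : ι → ℝ) :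
    ∑' k, ‖(α - Set.indicator (K : Set ι) α) k‖ₑ ^ 2
      = ∑' k, Set.indicator (K : Set ι)ᶜ (fun k => ‖α k‖ₑ ^ 2) k := by
  refine tsum_congr fun k => ?_
  by_cases hk : k ∈ K <;> simp [hk]

lemma tsum_eq_sum_add_tsum_compl (K : Finset ι) (g : ι → ℝ≥0∞) :
    ∑' k, g k = ∑ k ∈ K, g k + ∑' k, Set.indicator (K : Set ι)ᶜ g k := by
  have h1 : ∑ k ∈ K, g k = ∑' k, Set.indicator (K : Set ι) g k := by
    rw [← Finset.tsum_subtype' K g, tsum_subtype]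
  rw [h1, ← ENNReal.tsum_add]
  refine tsum_congr fun k => ?_
  by_cases hk : k ∈ K <;> simp [hk]

/-- Every best `n`-term approximation keeps entries of the sequence. -/
lemma IsBestNTerm.exists_eq_indicator [Nonempty ι] {n : ℕ} {α a : ι → ℝ}
    (hα : ∑' k, ‖α k‖ₑ ^ 2 ≠ ∞) (h : IsBestNTerm n α a) :
    ∃ K : Finset ι, K.card ≤ n ∧ a = Set.indicator (K : Set ι) α := by
  obtain ⟨⟨c, κ, ha⟩, hbest⟩ := h
  let K := Finset.univ.image κ
  have hK : K.card ≤ n := Finset.card_image_le.trans (by simp)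
  have hoff : ∀ k ∉ K, a k = 0 := fun k hk => by rw [ha]; exact nTerm_apply_eq_zero c κ hk
  refine ⟨K, hK, ?_⟩
  -- The competitor with the same index set and the exact entries of α has no error on K. Since the
  -- tail off K is common and finite, optimality of a leaves it no error on K either.
  obtain ⟨c', κ', h'⟩ := exists_nTerm_eq_indicator K hK α
  have hle : ell2Norm (α - a) ≤ ell2Norm (α - Set.indicator (K : Set ι) α) := by
    rw [hbest, h']
    exact nTermError_le α c' κ'
  rw [ell2Norm_le_iff, tsum_enorm_sq_sub_indicator, tsum_eq_sum_add_tsum_compl K] at hle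
  have hcompl : ∑' k, Set.indicator (K : Set ι)ᶜ (fun k => ‖(α - a) k‖ₑ ^ 2) k
      = ∑' k, Set.indicator (K : Set ι)ᶜ (fun k => ‖α k‖ₑ ^ 2) k := by
    refine tsum_congr fun k => ?_
    by_cases hk : k ∈ K
    · simp [hk]
    · simp [hk, hoff k hk]
  have hfin : ∑' k, Set.indicator (K : Set ι)ᶜ (fun k => ‖α k‖ₑ ^ 2) k ≠ ∞ :=
    ne_top_of_le_ne_top hα (ENNReal.tsum_le_tsum fun k => Set.indicator_le_self _ _ _)
  rw [hcompl] at hle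
  have hzero : ∑ k ∈ K, ‖(α - a) k‖ₑ ^ 2 = 0 := by
    by_contra hne
    exact absurd hle (not_le.mpr (by
      simpa [add_comm] using ENNReal.lt_add_right hfin hne))
  funext k
  by_cases hk : k ∈ K
  · have := (Finset.sum_eq_zero_iff.mp hzero) k hk
    have h3 : α k - a k = 0 := by simpa using this
    simp [hk]; linarith
  · simp [hk, hoff k hk]

/-- Only finitely many index sets matter: one of at most n points in the support with maximal energy
is optimal, because any n-term sum leaves at least the energy of α off its own indices. -/
lemma exists_isBestNTerm [Nonempty ι] (n : ℕ) (α : ι → ℝ) (hα : (Function.support α).Finite) :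
    ∃ a, IsBestNTerm n α a := by
  let F := hα.toFinset
  let P := F.powerset.filter fun K => K.card ≤ n
  have hP : P.Nonempty := ⟨∅, by simp [P]⟩
  obtain ⟨S, hS, hmax⟩ := P.exists_max_image (fun K => ∑ k ∈ K, ‖α k‖ₑ ^ 2) hP
  have hSc : S.card ≤ n := (Finset.mem_filter.mp hS).2
  obtain ⟨c, κ, h⟩ := exists_nTerm_eq_indicator S hSc α
  refine ⟨_, ⟨c, κ, h⟩, le_antisymm (le_nTermError fun c' κ' => ?_)
    (by rw [h]; exact nTermError_le α c κ)⟩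
  rw [ell2Norm_le_iff, tsum_enorm_sq_sub_indicator]
  let K := Finset.univ.image κ'
  have hoff : ∀ k ∉ F, α k = 0 := fun k hk => by simpa [F] using hk
  have hKP : K ∩ F ∈ P := Finset.mem_filter.mpr ⟨Finset.mem_powerset.mpr Finset.inter_subset_right,
    (Finset.card_le_card Finset.inter_subset_left).trans (Finset.card_image_le.trans (by simp))⟩
  have hm := hmax _ hKP
  have hfin : ∑ k ∈ S, ‖α k‖ₑ ^ 2 ≠ ∞ := by simp [ENNReal.sum_eq_top]
  have hsum := tsum_eq_sum_add_tsum_compl S fun k => ‖α k‖ₑ ^ 2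
  have hsum' := tsum_eq_sum_add_tsum_compl (K ∩ F) fun k => ‖α k‖ₑ ^ 2
  have h1 : ∑' k, Set.indicator (S : Set ι)ᶜ (fun k => ‖α k‖ₑ ^ 2) k
      ≤ ∑' k, Set.indicator ((K ∩ F : Finset ι) : Set ι)ᶜ (fun k => ‖α k‖ₑ ^ 2) k := by
    have : ∑ k ∈ S, ‖α k‖ₑ ^ 2 + ∑' k, Set.indicator (S : Set ι)ᶜ (fun k => ‖α k‖ₑ ^ 2) k ≤
        ∑ k ∈ S, ‖α k‖ₑ ^ 2 +
          ∑' k, Set.indicator ((K ∩ F : Finset ι) : Set ι)ᶜ (fun k => ‖α k‖ₑ ^ 2) k := by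
      rw [← hsum, hsum']
      gcongr
    exact (ENNReal.add_le_add_iff_left hfin).mp this
  refine h1.trans (ENNReal.tsum_le_tsum fun k => ?_)
  by_cases hk : k ∈ K ∩ F
  · simp only [Set.indicator_apply, Set.mem_compl_iff, SetLike.mem_coe, hk]; simp
  · have hk' : k ∉ K ∨ k ∉ F := by simpa [Finset.mem_inter, or_iff_not_imp_left] using hk
    rcases hk' with h2 | h2
    · refine (Set.indicator_le_self _ _ _).trans ?_
      simp [nTerm_apply_eq_zero c' κ' h2]
    · simp [Set.indicator_apply, hoff k h2]

/-- Thresholding an `ℓ₁`-sequence. -/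
lemma exists_subset_sum_sq_le (S : Finset ι) (α : ι → ℝ) (m : ℕ) :
    ∃ I ⊆ S, I.card ≤ m ∧ ∑ k ∈ S \ I, α k ^ 2 ≤ (∑ k ∈ S, |α k|) ^ 2 / (m + 1) := by
  set A := ∑ k ∈ S, |α k| with hA
  have hA0 : 0 ≤ A := Finset.sum_nonneg fun k _ => abs_nonneg _
  have hm : (0 : ℝ) < m + 1 := by positivity
  -- If m + 1 entries exceeded this threshold, their sum would exceed A.
  let I := S.filter fun k => A / (m + 1) < |α k|
  refine ⟨I, Finset.filter_subset _ _, ?_, ?_⟩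
  · by_contra! hc
    have hne : I.Nonempty := Finset.card_pos.mp (by omega)
    have h1 : ∑ _k ∈ I, A / (m + 1) < ∑ k ∈ I, |α k| :=
      Finset.sum_lt_sum_of_nonempty hne fun k hk => (Finset.mem_filter.mp hk).2
    have h2 : ∑ k ∈ I, |α k| ≤ A :=
      Finset.sum_le_sum_of_subset_of_nonneg (Finset.filter_subset _ _) fun _ _ _ => abs_nonneg _
    rw [Finset.sum_const, nsmul_eq_mul] at h1
    have h3 : (m + 1 : ℝ) ≤ I.card := by exact_mod_cast hc
    have h4 : (m + 1 : ℝ) * (A / (m + 1)) = A := by field_simp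
    have h5 : (m + 1 : ℝ) * (A / (m + 1)) ≤ I.card * (A / (m + 1)) := by gcongr
    linarith
  · calc ∑ k ∈ S \ I, α k ^ 2 ≤ ∑ k ∈ S \ I, A / (m + 1) * |α k| := by
          refine Finset.sum_le_sum fun k hk => ?_
          obtain ⟨h1, h2⟩ := Finset.mem_sdiff.mp hk
          have h3 : |α k| ≤ A / (m + 1) := by
            by_contra! h
            exact h2 (Finset.mem_filter.mpr ⟨h1, h⟩)
          rw [← sq_abs, sq]
          gcongr
      _ ≤ ∑ k ∈ S, A / (m + 1) * |α k| :=
          Finset.sum_le_sum_of_subset_of_nonneg Finset.sdiff_subset fun _ _ _ => by positivity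
      _ = A ^ 2 / (m + 1) := by rw [← Finset.mul_sum, ← hA]; ring

lemma nTermError_smul_le {𝕜 : Type} [NormedField 𝕜] (n : ℕ) {t : 𝕜} (ht : t ≠ 0) (α : ι → 𝕜) :
    nTermError n (t • α) ≤ ‖t‖ₑ * nTermError n α := by
  have h0 : ‖t‖ₑ ≠ 0 := by simpa using ht
  rw [mul_comm, ← ENNReal.div_le_iff h0 enorm_ne_top]
  refine le_nTermError fun c κ => ?_
  rw [ENNReal.div_le_iff h0 enorm_ne_top, mul_comm, ← ell2Norm_smul]
  refine (nTermError_le _ (t • c) κ).trans (le_of_eq ?_)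
  congr 1
  rw [smul_sub]
  congr 1
  simp only [nTerm, Finset.smul_sum]
  refine Finset.sum_congr rfl fun j _ => ?_
  rw [← Pi.single_smul]
  rfl

lemma nTermError_zero [Nonempty ι] {𝕜 : Type} [NormedField 𝕜] (n : ℕ) :
    nTermError n (0 : ι → 𝕜) = 0 := by
  refine le_antisymm ((nTermError_le 0 0 fun _ => Classical.arbitrary ι).trans (le_of_eq ?_)) zero_le
  simp [nTerm, ell2Norm]

/-- The width is taken over complex sequences, the expansion coefficients are real; taking real
parts of a complex competitor does not increase its error. -/
lemma nTermError_le_ofReal (n : ℕ) (α : ι → ℝ) :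
    nTermError n α ≤ nTermError n fun k => (α k : ℂ) := by
  refine le_nTermError fun c κ => (nTermError_le α (fun j => (c j).re) κ).trans ?_
  refine ENNReal.rpow_le_rpow (ENNReal.tsum_le_tsum fun k => ?_) (by norm_num)
  gcongr
  have h : (α - nTerm (fun j => (c j).re) κ) k
      = (((fun k => (α k : ℂ)) - nTerm c κ) k).re := by
    simp only [nTerm, Pi.sub_apply, Finset.sum_apply, Complex.sub_re, Complex.ofReal_re,
      Complex.re_sum, Pi.single_apply]
    congr 1
    refine Finset.sum_congr rfl fun j _ => ?_
    split_ifs <;> simp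
  rw [h, enorm_le_iff_norm_le]
  exact Complex.abs_re_le_norm _

end NTerm

/-! ### Frequencies and the width of the weighted sequence space -/

lemma PosFreq.ne_zero {d : ℕ} (k : PosFreq d) : k.1 ≠ 0 := by
  obtain ⟨k, j, -, hj⟩ := k
  rintro rfl
  simp at hj

lemma one_le_norm2 {d : ℕ} {k : Fin d → ℤ} (hk : k ≠ 0) : 1 ≤ norm2 k := by
  obtain ⟨j, hj⟩ := Function.ne_iff.mp hk
  rw [norm2, Real.one_le_sqrt]
  have h1 : (1 : ℝ) ≤ (k j : ℝ) ^ 2 := by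
    have : (1 : ℤ) ≤ (k j) ^ 2 := Int.add_one_le_iff.mpr (sq_pos_of_ne_zero hj)
    exact_mod_cast this
  exact h1.trans (Finset.single_le_sum (f := fun j => (k j : ℝ) ^ 2) (fun _ _ => sq_nonneg _)
    (Finset.mem_univ j))

/-- Integers satisfy |z| ≤ z². This is the dimension-free bound used when R < d. -/
lemma norm1_le_norm2_sq {d : ℕ} (k : Fin d → ℤ) : norm1 k ≤ norm2 k ^ 2 := by
  rw [norm2, Real.sq_sqrt (Finset.sum_nonneg fun _ _ => sq_nonneg _), norm1]
  refine Finset.sum_le_sum fun j _ => ?_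
  have : |k j| ≤ (k j) ^ 2 := by
    rcases eq_or_ne (k j) 0 with h | h
    · simp [h]
    · rw [← sq_abs]
      exact le_self_pow₀ (Int.one_le_abs h) two_ne_zero
  exact_mod_cast this

lemma norm1_le_sqrt_mul_norm2 {d : ℕ} (k : Fin d → ℤ) : norm1 k ≤ Real.sqrt d * norm2 k := by
  rw [norm2, ← Real.sqrt_mul (by positivity)]
  refine Real.le_sqrt_of_sq_le ?_
  have := sq_sum_le_card_mul_sum_sq (s := Finset.univ) (f := fun j => |(k j : ℝ)|)
  simpa [norm1] using this

lemma norm2_le_norm1 {d : ℕ} (k : Fin d → ℤ) : norm2 k ≤ norm1 k := by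
  refine Real.sqrt_le_iff.mpr ⟨Finset.sum_nonneg fun _ _ => abs_nonneg _, ?_⟩
  have := Finset.sum_sq_le_sq_sum_of_nonneg (s := Finset.univ) (f := fun j => |(k j : ℝ)|)
    fun _ _ => abs_nonneg _
  simpa [norm1] using this

lemma finite_norm2_le {d : ℕ} (R : ℝ) : {k : PosFreq d | norm2 k.1 ≤ R}.Finite := by
  have h : {k : Fin d → ℤ | norm2 k ≤ R}.Finite := by
    refine (Set.finite_Icc (fun _ => -⌈R⌉) fun _ => ⌈R⌉).subset fun k hk => ?_
    have hj : ∀ j, |k j| ≤ ⌈R⌉ := by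
      intro j
      have h1 : |(k j : ℝ)| ≤ norm2 k := by
        rw [← Real.sqrt_sq_eq_abs]
        exact Real.sqrt_le_sqrt (Finset.single_le_sum (f := fun j => (k j : ℝ) ^ 2)
          (fun _ _ => sq_nonneg _) (Finset.mem_univ j))
      have h2 : |(k j : ℝ)| ≤ ⌈R⌉ := (h1.trans hk).trans (Int.le_ceil R)
      exact_mod_cast h2
    exact ⟨fun j => (abs_le.mp (hj j)).1, fun j => (abs_le.mp (hj j)).2⟩
  exact Set.Finite.preimage Subtype.val_injective.injOn h

lemma nonempty_posFreq {d : ℕ} (hd : 1 ≤ d) : Nonempty (PosFreq d) :=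
  ⟨⟨fun _ => 1, ⟨0, hd⟩, fun i hi => absurd hi (by simp [Fin.lt_def]), one_pos⟩⟩

/-- By homogeneity. Norm zero is separate: the weights are at least 1, so the sequence vanishes. -/
lemma nTermError_le_bNorm_mul_sigmaN {d : ℕ} [Nonempty (PosFreq d)] {s : ℝ} (hs : 0 ≤ s) (n : ℕ)
    (α : PosFreq d → ℂ) (hα : bNorm s α ≠ ∞) : nTermError n α ≤ bNorm s α * sigmaN d s n := by
  by_cases h0 : bNorm s α = 0
  · have hz : α = 0 := by
      funext k
      have := ENNReal.tsum_eq_zero.mp h0 k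
      rcases mul_eq_zero.mp this with h | h
      · have : 1 ≤ norm2 k.1 ^ s := Real.one_le_rpow (one_le_norm2 k.ne_zero) hs
        rw [ENNReal.ofReal_eq_zero] at h
        linarith
      · simpa using h
    rw [hz, nTermError_zero]
    exact zero_le
  · set b := (bNorm s α).toReal with hb
    have hbpos : 0 < b := ENNReal.toReal_pos h0 hα
    have hbe : ‖(b : ℂ)‖ₑ = bNorm s α := by
      rw [← ofReal_norm, Complex.norm_real, Real.norm_of_nonneg hbpos.le,
        ENNReal.ofReal_toReal hα]
    have hbc : (b : ℂ) ≠ 0 := by exact_mod_cast hbpos.ne'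
    have h1 : bNorm s ((b : ℂ)⁻¹ • α) ≤ 1 := by
      have : ∀ k : PosFreq d, ENNReal.ofReal (norm2 k.1 ^ s) * ‖((b : ℂ)⁻¹ • α) k‖ₑ
          = ‖(b : ℂ)‖ₑ⁻¹ * (ENNReal.ofReal (norm2 k.1 ^ s) * ‖α k‖ₑ) := by
        intro k
        rw [Pi.smul_apply, smul_eq_mul, enorm_mul, enorm_inv hbc]
        ring
      rw [bNorm, tsum_congr this, ENNReal.tsum_mul_left, hbe]
      exact (ENNReal.inv_mul_cancel h0 hα).le
    calc nTermError n α = nTermError n ((b : ℂ) • ((b : ℂ)⁻¹ • α)) := by rw [smul_inv_smul₀ hbc]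
      _ ≤ ‖(b : ℂ)‖ₑ * nTermError n ((b : ℂ)⁻¹ • α) := nTermError_smul_le n hbc _
      _ ≤ bNorm s α * sigmaN d s n := by
        rw [hbe]
        gcongr
        exact le_iSup₂ (f := fun (α : PosFreq d → ℂ) (_ : bNorm s α ≤ 1) => nTermError n α) _ h1

/-- The frequency `e_i + 2 e_j`. -/
def pairFreq {d : ℕ} (p : Fin d × Fin d) : Fin d → ℤ := Pi.single p.1 1 + Pi.single p.2 2

/-- The unequal weights 1 and 2 make the ordered pair recoverable: the only odd entry sits at the
first index. This gives d² frequencies of norm at most 3, where unit vectors would give only d. -/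
lemma pairFreq_injective {d : ℕ} : Function.Injective (pairFreq (d := d)) := by
  rintro ⟨i, j⟩ ⟨i', j'⟩ h
  have h1 : i = i' := by
    by_contra hne
    have := congrFun h i
    simp only [pairFreq, Pi.add_apply, Pi.single_apply, if_true, if_neg hne] at this
    split_ifs at this <;> omega
  subst h1
  have h2 := add_left_cancel h
  by_contra hne
  have hj : j ≠ j' := fun h => hne (by rw [h])
  have := congrFun h2 j
  simp [hj] at this

lemma pairFreq_nonneg {d : ℕ} (p : Fin d × Fin d) (i : Fin d) : 0 ≤ pairFreq p i := by
  simp only [pairFreq, Pi.add_apply, Pi.single_apply]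
  split_ifs <;> norm_num

lemma exists_first_pos {d : ℕ} {k : Fin d → ℤ} (hk : k ≠ 0) :
    ∃ j, (∀ i, i < j → k i = 0) ∧ k j ≠ 0 := by
  obtain ⟨j, hj⟩ := Function.ne_iff.mp hk
  induction j using WellFoundedLT.induction with
  | ind j ih =>
    by_cases h : ∃ i, i < j ∧ k i ≠ 0
    · obtain ⟨i, hi, hi'⟩ := h
      exact ih i hi hi'
    · push Not at h
      exact ⟨j, h, hj⟩

lemma norm2_pairFreq_le {d : ℕ} (p : Fin d × Fin d) : norm2 (pairFreq p) ≤ 3 := by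
  refine (norm2_le_norm1 _).trans ?_
  have : norm1 (pairFreq p) = ((∑ j, pairFreq p j : ℤ) : ℝ) := by
    rw [norm1]
    push_cast
    refine Finset.sum_congr rfl fun j _ => abs_of_nonneg ?_
    exact_mod_cast pairFreq_nonneg p j
  rw [this]
  simp [pairFreq, Finset.sum_add_distrib]

lemma exists_finset_norm2_le_three {d N : ℕ} (hN : N ≤ d ^ 2) :
    ∃ A : Finset (PosFreq d), A.card = N ∧ ∀ k ∈ A, norm2 k.1 ≤ 3 := by
  have hpos : ∀ p : Fin d × Fin d, ∃ j, (∀ i, i < j → pairFreq p i = 0) ∧ 0 < pairFreq p j := by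
    intro p
    have hne : pairFreq p ≠ 0 := fun h => by
      have h1 := congrFun h p.1
      simp only [pairFreq, Pi.add_apply, Pi.single_apply, if_true, Pi.zero_apply] at h1
      split_ifs at h1 <;> omega
    obtain ⟨j, h1, h2⟩ := exists_first_pos hne
    exact ⟨j, h1, lt_of_le_of_ne (pairFreq_nonneg p j) h2.symm⟩
  let e : Fin d × Fin d ↪ PosFreq d := ⟨fun p => ⟨pairFreq p, hpos p⟩, fun p q h =>
    pairFreq_injective (Subtype.ext_iff.mp h)⟩
  obtain ⟨A, hA, hc⟩ := Finset.exists_subset_card_eq (s := Finset.univ.map e) (n := N)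
    (by simpa [sq] using hN)
  refine ⟨A, hc, fun k hk => ?_⟩
  obtain ⟨p, -, rfl⟩ := Finset.mem_map.mp (hA hk)
  exact norm2_pairFreq_le p

/-- The width is bounded from below by a flat sequence. -/
lemma ofReal_le_sigmaN {d n : ℕ} {s : ℝ} (hs1 : s ≤ 1) (hn : 1 ≤ n)
    (hnd : 2 * n ≤ d ^ 2) : ENNReal.ofReal ((6 * Real.sqrt n)⁻¹) ≤ sigmaN d s n := by
  obtain ⟨A, hA, hA3⟩ := exists_finset_norm2_le_three hnd
  -- The sequence has 2n entries of weight at most 3, so this height makes its weighted norm at most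
  -- 1.
  let t : ℝ := (6 * n : ℝ)⁻¹
  have hn0 : (0 : ℝ) < n := by exact_mod_cast hn
  have ht : 0 < t := by positivity
  let α : PosFreq d → ℂ := Set.indicator (A : Set (PosFreq d)) fun _ => (t : ℂ)
  have htn : ‖(t : ℂ)‖ₑ = ENNReal.ofReal t := by
    rw [← ofReal_norm, Complex.norm_real, Real.norm_of_nonneg ht.le]
  have hα : bNorm s α ≤ 1 := by
    have h1 : ∀ k : PosFreq d, ENNReal.ofReal (norm2 k.1 ^ s) * ‖α k‖ₑ
        ≤ Set.indicator (A : Set (PosFreq d)) (fun _ => ENNReal.ofReal (3 * t)) k := by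
      intro k
      by_cases hk : k ∈ A
      · simp only [α, Set.indicator_of_mem (Finset.mem_coe.mpr hk)]
        rw [htn, ← ENNReal.ofReal_mul (by unfold norm2; positivity)]
        refine ENNReal.ofReal_le_ofReal (mul_le_mul_of_nonneg_right ?_ ht.le)
        calc norm2 k.1 ^ s ≤ norm2 k.1 ^ (1 : ℝ) :=
              Real.rpow_le_rpow_of_exponent_le (one_le_norm2 k.ne_zero) hs1
          _ ≤ 3 := by rw [Real.rpow_one]; exact hA3 k hk
      · simp [α, hk]
    refine (ENNReal.tsum_le_tsum h1).trans ?_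
    rw [← tsum_subtype, Finset.tsum_subtype' A fun _ => ENNReal.ofReal (3 * t), Finset.sum_const, hA, nsmul_eq_mul,
      ← ENNReal.ofReal_natCast, ← ENNReal.ofReal_mul (by positivity), ← ENNReal.ofReal_one]
    refine ENNReal.ofReal_le_ofReal (le_of_eq ?_)
    simp only [t]
    push_cast
    field_simp
    norm_num
  refine le_trans ?_ (le_iSup₂ (f := fun (α : PosFreq d → ℂ) (_ : bNorm s α ≤ 1) =>
    nTermError n α) α hα)
  refine le_nTermError fun c κ => ?_
  let K := Finset.univ.image κ
  have hK : K.card ≤ n := Finset.card_image_le.trans (by simp)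
  -- An n-term sum misses at least n of the 2n equal entries, which leaves the error √n · t =
  -- 1/(6√n).
  have hAK : n ≤ (A \ K).card := by
    have := Finset.le_card_sdiff K A
    omega
  have h2 : ENNReal.ofReal (n * t ^ 2) ≤ ∑' k, ‖(α - nTerm c κ) k‖ₑ ^ 2 := by
    refine le_trans ?_ (ENNReal.sum_le_tsum (A \ K))
    have h3 : ∀ k ∈ A \ K, ‖(α - nTerm c κ) k‖ₑ ^ 2 = ENNReal.ofReal (t ^ 2) := by
      intro k hk
      obtain ⟨hk1, hk2⟩ := Finset.mem_sdiff.mp hk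
      rw [Pi.sub_apply, nTerm_apply_eq_zero c κ hk2, sub_zero]
      simp only [α, Set.indicator_of_mem (Finset.mem_coe.mpr hk1)]
      rw [htn, ENNReal.ofReal_pow ht.le]
    rw [Finset.sum_congr rfl h3, Finset.sum_const, nsmul_eq_mul, ENNReal.ofReal_mul hn0.le,
      ENNReal.ofReal_natCast]
    gcongr
  calc ENNReal.ofReal ((6 * Real.sqrt n)⁻¹) = ENNReal.ofReal (n * t ^ 2) ^ (1 / 2 : ℝ) := by
        rw [ENNReal.ofReal_rpow_of_nonneg (by positivity) (by norm_num), ← Real.sqrt_eq_rpow,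
          Real.sqrt_mul hn0.le, Real.sqrt_sq ht.le]
        congr 1
        simp only [t]
        have := Real.mul_self_sqrt hn0.le
        have h4 : 0 < Real.sqrt n := Real.sqrt_pos.mpr hn0
        field_simp
        nlinarith
    _ ≤ _ := ENNReal.rpow_le_rpow h2 (by norm_num)

/-! ### Fourier series of the piecewise linear system and their inversion -/

lemma summable_one_div_pnat_sq : Summable fun m : ℕ+ => 1 / (m : ℝ) ^ 2 :=
  (Real.summable_one_div_nat_pow.mpr one_lt_two).comp_injective PNat.coe_injective

/-- Möbius inversion for series `∑ j, χ j / j ^ 2 * φ (j t)` with completely multiplicative `χ`. -/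
lemma hasSum_moebius_inversion (χ : ℕ →* ℝ) (hχ : ∀ n, |χ n| ≤ 1) {φ Ψ : ℝ → ℝ}
    (hφ : ∀ t, |φ t| ≤ 1)
    (hΨ : ∀ t, HasSum (fun j : ℕ+ => χ j / (j : ℝ) ^ 2 * φ (j * t)) (Ψ t)) (t : ℝ) :
    HasSum (fun m : ℕ+ => ArithmeticFunction.moebius (m : ℕ) * χ m / (m : ℝ) ^ 2 * Ψ (m * t))
      (φ t) := by
  let G : ℕ+ × ℕ+ → ℝ := fun p => ArithmeticFunction.moebius (p.1 : ℕ) * χ p.1 / (p.1 : ℝ) ^ 2 *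
    (χ p.2 / (p.2 : ℝ) ^ 2 * φ (p.2 * (p.1 * t)))
  have hμ : ∀ m : ℕ, |(ArithmeticFunction.moebius m : ℝ)| ≤ 1 := fun m => by
    exact_mod_cast ArithmeticFunction.abs_moebius_le_one
  have hG : Summable G := by
    have hb := summable_one_div_pnat_sq.mul_of_nonneg summable_one_div_pnat_sq
      (fun m => by positivity) (fun m => by positivity)
    refine Summable.of_norm_bounded hb fun p => ?_
    have h1 : |ArithmeticFunction.moebius (p.1 : ℕ) * χ p.1 / (p.1 : ℝ) ^ 2| ≤ 1 / (p.1 : ℝ) ^ 2 := by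
      rw [abs_div, abs_mul, abs_of_pos (show (0 : ℝ) < (p.1 : ℝ) ^ 2 by positivity)]
      gcongr
      exact mul_le_one₀ (hμ _) (abs_nonneg _) (hχ _)
    have h2 : |χ p.2 / (p.2 : ℝ) ^ 2 * φ (p.2 * (p.1 * t))| ≤ 1 / (p.2 : ℝ) ^ 2 := by
      rw [abs_mul, abs_div, abs_of_pos (show (0 : ℝ) < (p.2 : ℝ) ^ 2 by positivity)]
      calc |χ p.2| / (p.2 : ℝ) ^ 2 * |φ (p.2 * (p.1 * t))| ≤ 1 / (p.2 : ℝ) ^ 2 * 1 := by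
            gcongr
            · exact hχ _
            · exact hφ _
        _ = _ := mul_one _
    rw [Real.norm_eq_abs, abs_mul]
    exact mul_le_mul h1 h2 (abs_nonneg _) (by positivity)
  -- Grouped by N = m j, multiplicativity makes χ(N)/N² φ(N t) a common factor of ∑_{m ∣ N} μ(m), so
  -- only N = 1 survives.
  have hinner : ∀ N : ℕ+, HasSum (fun c : Nat.divisorsAntidiagonal N =>
      (G ∘ sigmaAntidiagonalEquivProd) ⟨N, c⟩) (if N = 1 then φ t else 0) := by
    intro N
    have hterm : ∀ c : Nat.divisorsAntidiagonal N, (G ∘ sigmaAntidiagonalEquivProd) ⟨N, c⟩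
        = (χ N / (N : ℝ) ^ 2 * φ (N * t)) * ArithmeticFunction.moebius c.1.1 := by
      intro c
      have hc := (Nat.mem_divisorsAntidiagonal.mp c.2).1
      have hcR : (N : ℝ) = (c.1.1 : ℝ) * c.1.2 := by exact_mod_cast hc.symm
      have hcχ : χ N = χ c.1.1 * χ c.1.2 := by rw [← map_mul, hc]
      have h1 : ((sigmaAntidiagonalEquivProd ⟨N, c⟩).1 : ℕ) = c.1.1 := rfl
      have h2 : ((sigmaAntidiagonalEquivProd ⟨N, c⟩).2 : ℕ) = c.1.2 := rfl
      simp only [Function.comp, G, h1, h2]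
      rw [hcχ, hcR, show (c.1.2 : ℝ) * (c.1.1 * t) = c.1.1 * c.1.2 * t by ring]
      ring
    have hsum : ∑ c : Nat.divisorsAntidiagonal N, (ArithmeticFunction.moebius c.1.1 : ℝ)
        = if N = 1 then 1 else 0 := by
      rw [Finset.sum_coe_sort (Nat.divisorsAntidiagonal N)
        fun c => (ArithmeticFunction.moebius c.1 : ℝ)]
      have h := congrArg (fun f : ArithmeticFunction ℤ => f N)
        ArithmeticFunction.moebius_mul_coe_zeta
      simp only [ArithmeticFunction.mul_apply, ArithmeticFunction.one_apply] at h
      have h3 : ∑ c ∈ Nat.divisorsAntidiagonal N, ArithmeticFunction.moebius c.1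
          = if (N : ℕ) = 1 then 1 else 0 := by
        rw [← h]
        refine Finset.sum_congr rfl fun c hc => ?_
        have : c.2 ≠ 0 := fun h0 => by
          have := (Nat.mem_divisorsAntidiagonal.mp hc).1
          simp [h0] at this
          exact N.ne_zero this.symm
        simp [ArithmeticFunction.natCoe_apply, ArithmeticFunction.zeta_apply, this]
      have h4 := congrArg (fun z : ℤ => (z : ℝ)) h3
      push_cast at h4
      rw [h4]
      simp
    have := hasSum_fintype fun c : Nat.divisorsAntidiagonal N =>
      (G ∘ sigmaAntidiagonalEquivProd) ⟨N, c⟩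
    convert this using 1
    rw [Finset.sum_congr rfl fun c _ => hterm c, ← Finset.mul_sum, hsum]
    split_ifs with h
    · subst h; simp
    · simp
  have hval := (sigmaAntidiagonalEquivProd.hasSum_iff.mpr hG.hasSum).sigma hinner
  have hval' := hval.unique (hasSum_ite_eq 1 (φ t))
  have hfin := hG.hasSum.prod_fiberwise
    fun m => (hΨ (m * t)).mul_left (ArithmeticFunction.moebius (m : ℕ) * χ m / (m : ℝ) ^ 2)
  rwa [hval'] at hfin

/-- The trivial character modulo 2. -/
def oddChar : ℕ →* ℝ where
  toFun n := if Odd n then 1 else 0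
  map_one' := by simp
  map_mul' m n := by
    by_cases hm : Odd m <;> by_cases hn : Odd n <;> simp [Nat.odd_mul, hm, hn]

/-- The nontrivial character modulo 4. -/
def fourChar : ℕ →* ℝ where
  toFun n := ((ZMod.χ₄ n : ℤ) : ℝ)
  map_one' := by simp
  map_mul' m n := by rw [Nat.cast_mul, map_mul, Int.cast_mul]

lemma abs_oddChar_le (n : ℕ) : |oddChar n| ≤ 1 := by
  change |if Odd n then (1 : ℝ) else 0| ≤ 1
  split_ifs <;> simp

lemma abs_fourChar_le (n : ℕ) : |fourChar n| ≤ 1 := by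
  change |((ZMod.χ₄ n : ℤ) : ℝ)| ≤ 1
  rw [ZMod.χ₄_nat_eq_if_mod_four]
  split_ifs <;> simp

lemma hasSum_cos_div_sq {x : ℝ} (hx : x ∈ Set.Icc (0 : ℝ) 1) :
    HasSum (fun n : ℕ => 1 / (n : ℝ) ^ 2 * Real.cos (2 * Real.pi * n * x))
      (Real.pi ^ 2 * (x ^ 2 - x + 1 / 6)) := by
  have h := hasSum_one_div_nat_pow_mul_cos one_ne_zero hx
  have hB : (Polynomial.map (algebraMap ℚ ℝ) (Polynomial.bernoulli (2 * 1))).eval x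
      = x ^ 2 - x + 1 / 6 := by
    simp [Polynomial.bernoulli_def, Finset.sum_range_succ, bernoulli]
    ring
  rw [hB] at h
  convert h using 1
  norm_num [Nat.factorial]
  ring

/-- The even terms form a quarter of the full series at 2x; subtracting them cancels the quadratic
part of the Bernoulli polynomial. The restriction x ≤ 1/2 keeps 2x in [0,1]. -/
lemma hasSum_odd_cos_div_sq {x : ℝ} (h0 : 0 ≤ x) (h1 : x ≤ 1 / 2) :
    HasSum (fun n : ℕ => oddChar n / (n : ℝ) ^ 2 * Real.cos (2 * Real.pi * (n * x)))
      (Real.pi ^ 2 / 8 * (1 - 4 * x)) := by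
  have h2 : HasSum (fun n : ℕ => if Odd n then 0 else
      1 / (n : ℝ) ^ 2 * Real.cos (2 * Real.pi * n * x))
      (1 / 4 * (Real.pi ^ 2 * ((2 * x) ^ 2 - 2 * x + 1 / 6)) + 0) := by
    refine HasSum.even_add_odd ?_ ?_
    · have := (hasSum_cos_div_sq (x := 2 * x) ⟨by linarith, by linarith⟩).mul_left (1 / 4)
      convert! this using 2 with n
      rw [if_neg (by simp)]
      push_cast
      rw [show 2 * Real.pi * (2 * n : ℝ) * x = 2 * Real.pi * n * (2 * x) by ring]
      ring
    · convert hasSum_zero using 2 with n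
      simp
  have h3 := (hasSum_cos_div_sq (x := x) ⟨h0, by linarith⟩).sub h2
  convert! h3 using 1
  · funext n
    change (if Odd n then (1 : ℝ) else 0) / (n : ℝ) ^ 2 * _ = _
    rw [mul_assoc (2 * Real.pi)]
    split_ifs <;> ring
  · ring

/-- The Fourier series of the piecewise linear cosine. -/
lemma hasSum_plCos (t : ℝ) :
    HasSum (fun n : ℕ => oddChar n / (n : ℝ) ^ 2 * Real.cos (2 * Real.pi * (n * t)))
      (Real.pi ^ 2 / 8 * plCos t) := by
  have hfr : ∀ n : ℕ, Real.cos (2 * Real.pi * (n * t)) = Real.cos (2 * Real.pi * (n * Int.fract t)) := by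
    intro n
    conv_lhs => rw [← Int.fract_add_floor t]
    rw [show 2 * Real.pi * (n * (Int.fract t + ⌊t⌋)) = 2 * Real.pi * (n * Int.fract t)
      + ((n * ⌊t⌋ : ℤ) : ℝ) * (2 * Real.pi) by push_cast; ring]
    exact Real.cos_add_int_mul_two_pi _ _
  simp only [hfr, plCos]
  have h0 := Int.fract_nonneg t
  have h1 := (Int.fract_lt_one t).le
  generalize Int.fract t = y at *
  rcases le_total y (1 / 2) with h | h
  · rw [abs_of_nonpos (by linarith)]
    convert hasSum_odd_cos_div_sq h0 h using 2
    ring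
  · rw [abs_of_nonneg (by linarith)]
    convert hasSum_odd_cos_div_sq (x := 1 - y) (by linarith) (by linarith) using 2 with n
    · rw [show 2 * Real.pi * (n * (1 - y)) = -(2 * Real.pi * (n * y)) + (n : ℝ) * (2 * Real.pi)
        by ring, Real.cos_add_nat_mul_two_pi, Real.cos_neg]
    · ring

/-- The Fourier series of the piecewise linear sine. -/
lemma hasSum_plSin (t : ℝ) :
    HasSum (fun n : ℕ => fourChar n / (n : ℝ) ^ 2 * Real.sin (2 * Real.pi * (n * t)))
      (Real.pi ^ 2 / 8 * plSin t) := by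
  rw [plSin_eq_plCos]
  convert hasSum_plCos (t + 3 / 4) using 2 with n
  change ((ZMod.χ₄ n : ℤ) : ℝ) / (n : ℝ) ^ 2 * _ = (if Odd n then (1 : ℝ) else 0) / (n : ℝ) ^ 2 * _
  rw [ZMod.χ₄_nat_eq_if_mod_four]
  by_cases h2 : n % 2 = 0
  · have ho : ¬Odd n := by rw [Nat.odd_iff]; omega
    simp [h2, ho]
  · have ho : Odd n := by rw [Nat.odd_iff]; omega
    simp only [if_neg h2, if_pos ho]
    -- Modulo 1, the shift 3n/4 is -1/4 for n ≡ 1 and +1/4 for n ≡ 3 mod 4, which turns the cosine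
    -- into plus or minus the sine.
    by_cases h4 : n % 4 = 1
    · simp only [if_pos h4]
      obtain ⟨q, rfl⟩ : ∃ q, n = 4 * q + 1 := ⟨n / 4, by omega⟩
      rw [show 2 * Real.pi * (((4 * q + 1 : ℕ) : ℝ) * (t + 3 / 4))
        = (2 * Real.pi * (((4 * q + 1 : ℕ) : ℝ) * t) - Real.pi / 2)
          + ((3 * q + 1 : ℕ) : ℝ) * (2 * Real.pi) by push_cast; ring,
        Real.cos_add_nat_mul_two_pi, Real.cos_sub_pi_div_two]
      simp
    · simp only [if_neg h4]
      obtain ⟨q, rfl⟩ : ∃ q, n = 4 * q + 3 := ⟨n / 4, by omega⟩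
      rw [show 2 * Real.pi * (((4 * q + 3 : ℕ) : ℝ) * (t + 3 / 4))
        = (2 * Real.pi * (((4 * q + 3 : ℕ) : ℝ) * t) + Real.pi / 2)
          + ((3 * q + 2 : ℕ) : ℝ) * (2 * Real.pi) by push_cast; ring,
        Real.cos_add_nat_mul_two_pi, Real.cos_add_pi_div_two]
      push_cast
      ring

lemma hasSum_pnat_of_nat {f : ℕ → ℝ} {a : ℝ} (h0 : f 0 = 0) (h : HasSum f a) :
    HasSum (fun n : ℕ+ => f n) a :=
  (Function.Injective.hasSum_iff PNat.coe_injective fun n hn => by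
    rcases Nat.eq_zero_or_pos n with rfl | hn'
    · exact h0
    · exact absurd ⟨⟨n, hn'⟩, rfl⟩ hn).mpr h

lemma exists_hasSum_of_hasSum_char (χ : ℕ →* ℝ) (hχ : ∀ n, |χ n| ≤ 1) {φ ψ : ℝ → ℝ}
    (hφ : ∀ t, |φ t| ≤ 1)
    (hψ : ∀ t, HasSum (fun j : ℕ => χ j / (j : ℝ) ^ 2 * φ (j * t)) (Real.pi ^ 2 / 8 * ψ t)) :
    ∃ l : ℕ+ → ℝ, (∀ m, |l m| ≤ 2 / (m : ℝ) ^ 2) ∧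
      ∀ t, HasSum (fun m => l m * ψ (m * t)) (φ t) := by
  refine ⟨fun m => ArithmeticFunction.moebius (m : ℕ) * χ m / (m : ℝ) ^ 2 * (Real.pi ^ 2 / 8),
    fun m => ?_, fun t => ?_⟩
  · have hπ : Real.pi ^ 2 / 8 ≤ 2 := by nlinarith [Real.pi_le_four, Real.pi_pos]
    rw [abs_mul, abs_div, abs_mul, abs_of_pos (show (0 : ℝ) < (m : ℝ) ^ 2 by positivity),
      abs_of_pos (show (0 : ℝ) < Real.pi ^ 2 / 8 by positivity)]
    have hμ : |(ArithmeticFunction.moebius (m : ℕ) : ℝ)| ≤ 1 := by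
      exact_mod_cast ArithmeticFunction.abs_moebius_le_one
    calc _ ≤ 1 / (m : ℝ) ^ 2 * 2 := by
          gcongr
          exact mul_le_one₀ hμ (abs_nonneg _) (hχ _)
      _ = _ := by ring
  · have := hasSum_moebius_inversion χ hχ hφ (Ψ := fun t => Real.pi ^ 2 / 8 * ψ t)
      (fun t => hasSum_pnat_of_nat (f := fun j : ℕ => χ j / (j : ℝ) ^ 2 * φ (j * t)) (by simp) (hψ t)) t
    convert this using 2 with m
    ring

lemma exists_hasSum_plCos : ∃ l : ℕ+ → ℝ, (∀ m, |l m| ≤ 2 / (m : ℝ) ^ 2) ∧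
    ∀ t, HasSum (fun m => l m * plCos (m * t)) (Real.cos (2 * Real.pi * t)) :=
  exists_hasSum_of_hasSum_char oddChar abs_oddChar_le (φ := fun t => Real.cos (2 * Real.pi * t))
    (fun _ => Real.abs_cos_le_one _) hasSum_plCos

lemma exists_hasSum_plSin : ∃ l : ℕ+ → ℝ, (∀ m, |l m| ≤ 2 / (m : ℝ) ^ 2) ∧
    ∀ t, HasSum (fun m => l m * plSin (m * t)) (Real.sin (2 * Real.pi * t)) :=
  exists_hasSum_of_hasSum_char fourChar abs_fourChar_le (φ := fun t => Real.sin (2 * Real.pi * t))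
    (fun _ => Real.abs_sin_le_one _) hasSum_plSin

/-- Continuity across the integers comes from the uniform convergence of the Fourier series. -/
lemma continuous_plCos : Continuous plCos := by
  have h : plCos = fun t => 8 / Real.pi ^ 2 *
      ∑' n : ℕ, oddChar n / (n : ℝ) ^ 2 * Real.cos (2 * Real.pi * (n * t)) := by
    funext t
    rw [(hasSum_plCos t).tsum_eq]
    field_simp
  rw [h]
  refine continuous_const.mul (continuous_tsum (fun n => by fun_prop)
    (Real.summable_one_div_nat_pow.mpr one_lt_two) fun n t => ?_)
  rw [Real.norm_eq_abs, abs_mul, abs_div, abs_of_nonneg (show (0 : ℝ) ≤ (n : ℝ) ^ 2 by positivity)]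
  calc _ ≤ 1 / (n : ℝ) ^ 2 * 1 := by
        gcongr
        · exact abs_oddChar_le n
        · exact Real.abs_cos_le_one _
    _ = _ := mul_one _

lemma continuous_plSin : Continuous plSin := by
  rw [funext plSin_eq_plCos]
  exact continuous_plCos.comp (by fun_prop)

/-! ### The `L₂`-bound for the piecewise linear system -/

lemma volume_restrict_cube (d : ℕ) :
    (volume : Measure (Fin d → ℝ)).restrict (cube d)
      = Measure.pi fun _ => (volume : Measure ℝ).restrict (Set.Icc 0 1) := by
  rw [← Measure.restrict_pi_pi, cube, ← Set.pi_univ_Icc]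
  rfl

instance isProbabilityMeasure_cube (d : ℕ) :
    IsProbabilityMeasure ((volume : Measure (Fin d → ℝ)).restrict (cube d)) := by
  refine ⟨?_⟩
  rw [volume_restrict_cube, Measure.pi_univ]
  simp

lemma continuous_freqDot {d : ℕ} (m : Fin d → ℤ) : Continuous (freqDot m) := by
  unfold freqDot
  fun_prop

lemma integral_Icc_exp_eq_zero {n : ℤ} (hn : n ≠ 0) :
    ∫ x in Set.Icc (0 : ℝ) 1, Complex.exp (2 * Real.pi * Complex.I * n * x) = 0 := by
  have hc : (2 * Real.pi * Complex.I * n : ℂ) ≠ 0 := by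
    simp [Real.pi_ne_zero, hn]
  rw [integral_Icc_eq_integral_Ioc, ← intervalIntegral.integral_of_le zero_le_one,
    integral_exp_mul_complex hc]
  have : Complex.exp (2 * Real.pi * Complex.I * n) = 1 := by
    rw [mul_comm]
    exact Complex.exp_int_mul_two_pi_mul_I n
  simp [this]

lemma integral_cube_exp_eq_zero {d : ℕ} {m : Fin d → ℤ} (hm : m ≠ 0) :
    ∫ x in cube d, Complex.exp (2 * Real.pi * Complex.I * (freqDot m x : ℝ)) = 0 := by
  obtain ⟨j, hj⟩ := Function.ne_iff.mp hm
  have h : ∀ x : Fin d → ℝ, Complex.exp (2 * Real.pi * Complex.I * (freqDot m x : ℝ))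
      = ∏ i, Complex.exp (2 * Real.pi * Complex.I * (m i) * (x i)) := by
    intro x
    rw [← Complex.exp_sum, freqDot]
    push_cast
    rw [Finset.mul_sum]
    congr 1
    exact Finset.sum_congr rfl fun i _ => by ring
  simp only [h]
  rw [volume_restrict_cube, integral_fintype_prod_eq_prod
    (fun (i : Fin d) (y : ℝ) => Complex.exp (2 * Real.pi * Complex.I * (m i) * y))]
  exact Finset.prod_eq_zero (Finset.mem_univ j) (integral_Icc_exp_eq_zero hj)

lemma integrable_cube {d : ℕ} {E : Type} [NormedAddCommGroup E] {f : (Fin d → ℝ) → E}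
    (hf : Continuous f) : Integrable f (volume.restrict (cube d)) :=
  hf.continuousOn.integrableOn_compact isCompact_Icc

lemma integral_cube_cos_eq_zero {d : ℕ} {m : Fin d → ℤ} (hm : m ≠ 0) (θ : ℝ) :
    ∫ x in cube d, Real.cos (2 * Real.pi * freqDot m x + θ) = 0 := by
  have h : ∀ x : Fin d → ℝ, Real.cos (2 * Real.pi * freqDot m x + θ)
      = (Complex.exp (θ * Complex.I) * Complex.exp (2 * Real.pi * Complex.I * (freqDot m x : ℝ))).re := by
    intro x
    rw [← Complex.exp_add, show (θ * Complex.I + 2 * Real.pi * Complex.I * (freqDot m x : ℝ) : ℂ)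
      = ((2 * Real.pi * freqDot m x + θ : ℝ) : ℂ) * Complex.I by push_cast; ring,
      Complex.exp_ofReal_mul_I_re]
  have hc := continuous_freqDot m
  have hint := integral_re (𝕜 := ℂ) (integrable_cube (f := fun x : Fin d → ℝ =>
    Complex.exp (θ * Complex.I) * Complex.exp (2 * Real.pi * Complex.I * (freqDot m x : ℝ)))
    (by fun_prop))
  simp only [h]
  refine hint.trans ?_
  rw [integral_const_mul, integral_cube_exp_eq_zero hm, mul_zero]
  simp

lemma freqDot_add {d : ℕ} (k l : Fin d → ℤ) (x : Fin d → ℝ) :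
    freqDot (k + l) x = freqDot k x + freqDot l x := by
  simp [freqDot, add_mul, Finset.sum_add_distrib]

lemma freqDot_sub {d : ℕ} (k l : Fin d → ℤ) (x : Fin d → ℝ) :
    freqDot (k - l) x = freqDot k x - freqDot l x := by
  simp [freqDot, sub_mul, Finset.sum_sub_distrib]

lemma freqDot_nsmul {d : ℕ} (n : ℕ) (k : Fin d → ℤ) (x : Fin d → ℝ) :
    freqDot (n • k) x = n * freqDot k x := by
  simp [freqDot, Finset.mul_sum, mul_assoc]

/-- The earlier of the two leading positive entries cannot be cancelled. Hence the cosine of the sum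
frequency in a product of two cosines integrates to zero. -/
lemma PosFreq.add_ne_zero {d : ℕ} (k l : PosFreq d) : k.1 + l.1 ≠ 0 := by
  obtain ⟨k, j, hj, hj'⟩ := k
  obtain ⟨l, i, hi, hi'⟩ := l
  intro h
  rcases lt_trichotomy i j with hij | rfl | hij
  · have := congrFun h i
    have h1 := hj i hij
    simp only [Pi.add_apply, Pi.zero_apply] at this
    omega
  · have := congrFun h i
    simp only [Pi.add_apply, Pi.zero_apply] at this
    omega
  · have := congrFun h j
    have h1 := hi j hij
    simp only [Pi.add_apply, Pi.zero_apply] at this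
    omega

lemma integral_cube_cos_mul_cos {d n : ℕ} (hn : n ≠ 0) (k l : PosFreq d) (θ : ℝ) :
    ∫ x in cube d, Real.cos (2 * Real.pi * (n * (freqDot k.1 x + θ))) *
      Real.cos (2 * Real.pi * (n * (freqDot l.1 x + θ))) = if k = l then 1 / 2 else 0 := by
  have hprod : ∀ x : Fin d → ℝ, Real.cos (2 * Real.pi * (n * (freqDot k.1 x + θ))) *
      Real.cos (2 * Real.pi * (n * (freqDot l.1 x + θ)))
      = 1 / 2 * Real.cos (2 * Real.pi * freqDot (n • (k.1 + l.1)) x + 4 * Real.pi * n * θ)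
        + 1 / 2 * Real.cos (2 * Real.pi * freqDot (n • (k.1 - l.1)) x + 0) := by
    intro x
    rw [freqDot_nsmul, freqDot_nsmul, freqDot_add, freqDot_sub]
    have h1 := Real.cos_add (2 * Real.pi * (n * (freqDot k.1 x + θ)))
      (2 * Real.pi * (n * (freqDot l.1 x + θ)))
    have h2 := Real.cos_sub (2 * Real.pi * (n * (freqDot k.1 x + θ)))
      (2 * Real.pi * (n * (freqDot l.1 x + θ)))
    rw [show 2 * Real.pi * (n * (freqDot k.1 x + freqDot l.1 x)) + 4 * Real.pi * n * θ
      = 2 * Real.pi * (n * (freqDot k.1 x + θ)) + 2 * Real.pi * (n * (freqDot l.1 x + θ)) by ring,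
      show 2 * Real.pi * (n * (freqDot k.1 x - freqDot l.1 x)) + 0
      = 2 * Real.pi * (n * (freqDot k.1 x + θ)) - 2 * Real.pi * (n * (freqDot l.1 x + θ)) by ring,
      h1, h2]
    ring
  have hc := fun m => continuous_freqDot (d := d) m
  simp only [hprod]
  rw [integral_add (integrable_cube (by fun_prop)) (integrable_cube (by fun_prop)),
    integral_const_mul, integral_const_mul,
    integral_cube_cos_eq_zero (smul_ne_zero hn (PosFreq.add_ne_zero k l))]
  split_ifs with h
  · subst h
    simp [freqDot]
  · rw [integral_cube_cos_eq_zero (smul_ne_zero hn (sub_ne_zero.mpr fun h' => h (Subtype.ext h')))]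
    simp

lemma eLpNorm_cube_le {d : ℕ} {h : (Fin d → ℝ) → ℝ} (hc : Continuous h) {D : ℝ} (hD : 0 ≤ D)
    (hi : ∫ x in cube d, h x ^ 2 ≤ D ^ 2) :
    eLpNorm h 2 (volume.restrict (cube d)) ≤ ENNReal.ofReal D := by
  have h1 : ∫⁻ x in cube d, ‖h x‖ₑ ^ (2 : ℝ) = ENNReal.ofReal (∫ x in cube d, h x ^ 2) := by
    rw [ofReal_integral_eq_lintegral_ofReal (integrable_cube (by fun_prop))
      (ae_of_all _ fun x => sq_nonneg _)]
    refine lintegral_congr fun x => ?_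
    rw [← sq_abs, ENNReal.ofReal_pow (abs_nonneg _), ← Real.norm_eq_abs, ofReal_norm]
    norm_cast
  rw [eLpNorm_eq_lintegral_rpow_enorm_toReal (by norm_num) (by norm_num), ENNReal.toReal_ofNat, h1,
    ENNReal.ofReal_rpow_of_nonneg (integral_nonneg fun x => sq_nonneg _) (by norm_num),
    ← Real.sqrt_eq_rpow]
  exact ENNReal.ofReal_le_ofReal (Real.sqrt_le_iff.mpr ⟨hD, hi⟩)

lemma eLpNorm_sum_cos_le {d : ℕ} (n : ℕ) (θ : ℝ) (F : Finset (PosFreq d)) (γ : PosFreq d → ℝ)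
    {D : ℝ} (hD : 0 ≤ D) (hγ : ∑ k ∈ F, γ k ^ 2 ≤ D ^ 2) (hn : n ≠ 0) :
    eLpNorm (fun x => ∑ k ∈ F, γ k * Real.cos (2 * Real.pi * (n * (freqDot k.1 x + θ)))) 2
      (volume.restrict (cube d)) ≤ ENNReal.ofReal D := by
  have hc := fun m => continuous_freqDot (d := d) m
  refine eLpNorm_cube_le (by fun_prop) hD ?_
  have hsq : ∀ x : Fin d → ℝ,
      (∑ k ∈ F, γ k * Real.cos (2 * Real.pi * (n * (freqDot k.1 x + θ)))) ^ 2
      = ∑ k ∈ F, ∑ l ∈ F, γ k * γ l * (Real.cos (2 * Real.pi * (n * (freqDot k.1 x + θ))) *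
        Real.cos (2 * Real.pi * (n * (freqDot l.1 x + θ)))) := by
    intro x
    rw [sq, Finset.sum_mul_sum]
    exact Finset.sum_congr rfl fun k _ => Finset.sum_congr rfl fun l _ => by ring
  simp only [hsq]
  rw [integral_finsetSum _ fun k _ => integrable_cube (by fun_prop)]
  have h1 : ∀ k ∈ F, ∫ x in cube d, ∑ l ∈ F, γ k * γ l *
      (Real.cos (2 * Real.pi * (n * (freqDot k.1 x + θ))) *
        Real.cos (2 * Real.pi * (n * (freqDot l.1 x + θ)))) = γ k ^ 2 * (1 / 2) := by
    intro k hk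
    rw [integral_finsetSum _ fun l _ => integrable_cube (by fun_prop)]
    simp only [integral_const_mul, integral_cube_cos_mul_cos hn]
    simp [hk, sq]
  rw [Finset.sum_congr rfl h1, ← Finset.sum_mul]
  have := Finset.sum_nonneg fun k (_ : k ∈ F) => sq_nonneg (γ k)
  linarith

lemma hasSum_oddChar_div_sq :
    HasSum (fun n : ℕ => 8 / Real.pi ^ 2 * (oddChar n / (n : ℝ) ^ 2)) 1 := by
  have h := (hasSum_plCos 0).mul_left (8 / Real.pi ^ 2)
  have h0 : plCos 0 = 1 := by rw [plCos, Int.fract_zero]; norm_num [abs_of_pos]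
  rw [h0] at h
  convert! h using 1
  · simp
  · field_simp

lemma oddChar_nonneg (n : ℕ) : 0 ≤ oddChar n := by
  change 0 ≤ if Odd n then (1 : ℝ) else 0
  split_ifs <;> simp

/-- Upper Riesz bound for the piecewise linear system, with constant one. -/
lemma eLpNorm_sum_plCos_le {d : ℕ} (θ : ℝ) (F : Finset (PosFreq d)) (γ : PosFreq d → ℝ)
    {D : ℝ} (hD : 0 ≤ D) (hγ : ∑ k ∈ F, γ k ^ 2 ≤ D ^ 2) :
    eLpNorm (fun x => ∑ k ∈ F, γ k * plCos (freqDot k.1 x + θ)) 2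
      (volume.restrict (cube d)) ≤ ENNReal.ofReal D := by
  have hc := fun m => continuous_freqDot (d := d) m
  -- These weights are nonnegative with sum `plCos 0` = 1. For each n ≠ 0 the dilated cosines are
  -- orthogonal with squared norm 1/2, so the triangle inequality over n gives the constant one.
  let w : ℕ → ℝ := fun n => 8 / Real.pi ^ 2 * (oddChar n / (n : ℝ) ^ 2)
  have hw : ∀ n, 0 ≤ w n := fun n => by
    have := oddChar_nonneg n
    positivity
  let h : ℕ → (Fin d → ℝ) → ℝ := fun n x =>
    ∑ k ∈ F, γ k * Real.cos (2 * Real.pi * (n * (freqDot k.1 x + θ)))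
  have hcont : ∀ n, Continuous (w n • h n) := fun n => by
    change Continuous fun x => w n * ∑ k ∈ F, γ k * Real.cos (2 * Real.pi * (n * (freqDot k.1 x + θ)))
    fun_prop
  have hterm : ∀ n, eLpNorm (w n • h n) 2 (volume.restrict (cube d)) ≤ ENNReal.ofReal (w n * D) := by
    intro n
    rw [eLpNorm_const_smul, ENNReal.ofReal_mul (hw n), ← Real.enorm_of_nonneg (hw n)]
    rcases eq_or_ne n 0 with rfl | hn
    · simp [w]
    · gcongr
      exact eLpNorm_sum_cos_le n θ F γ hD hγ hn
  have hpart : ∀ N, eLpNorm (∑ n ∈ Finset.range N, w n • h n) 2 (volume.restrict (cube d))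
      ≤ ENNReal.ofReal D := by
    intro N
    refine (eLpNorm_sum_le (fun n _ => (hcont n).aestronglyMeasurable) (by norm_num)).trans ?_
    refine (Finset.sum_le_sum fun n _ => hterm n).trans ?_
    rw [← ENNReal.ofReal_sum_of_nonneg fun n _ => mul_nonneg (hw n) hD, ← Finset.sum_mul]
    refine ENNReal.ofReal_le_ofReal ?_
    have := sum_le_hasSum (Finset.range N) (fun n _ => hw n) hasSum_oddChar_div_sq
    exact mul_le_of_le_one_left hD this
  -- Fatou's lemma carries the bound from the partial sums to the pointwise limit.
  refine (Lp.eLpNorm_lim_le_liminf_eLpNorm (f := fun N => ∑ n ∈ Finset.range N, w n • h n)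
    (fun N => Finset.aestronglyMeasurable_sum _ fun n _ => (hcont n).aestronglyMeasurable) _
    (ae_of_all _ fun x => ?_)).trans
    (liminf_le_of_frequently_le' (Frequently.of_forall hpart))
  have hs : HasSum (fun n => (w n • h n) x) (∑ k ∈ F, γ k * plCos (freqDot k.1 x + θ)) := by
    have h1 : HasSum (fun n : ℕ => ∑ k ∈ F, γ k * (8 / Real.pi ^ 2 * (oddChar n / (n : ℝ) ^ 2 *
        Real.cos (2 * Real.pi * (n * (freqDot k.1 x + θ))))))
        (∑ k ∈ F, γ k * (8 / Real.pi ^ 2 * (Real.pi ^ 2 / 8 * plCos (freqDot k.1 x + θ)))) :=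
      hasSum_sum fun k _ => ((hasSum_plCos (freqDot k.1 x + θ)).mul_left _).mul_left _
    convert h1 using 1
    · funext n
      simp only [Pi.smul_apply, smul_eq_mul, w, h, Finset.mul_sum]
      exact Finset.sum_congr rfl fun k _ => by ring
    · refine Finset.sum_congr rfl fun k _ => ?_
      field_simp
  simpa using hs.tendsto_sum_nat

/-! ### Expansion of Barron functions in the piecewise linear system -/

lemma norm2_nonneg {d : ℕ} (k : Fin d → ℤ) : 0 ≤ norm2 k := Real.sqrt_nonneg _

lemma norm2_nsmul {d : ℕ} (n : ℕ) (k : Fin d → ℤ) : norm2 (n • k) = n * norm2 k := by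
  have h : ∑ j, (((n • k) j : ℤ) : ℝ) ^ 2 = (n : ℝ) ^ 2 * ∑ j, (k j : ℝ) ^ 2 := by
    rw [Finset.mul_sum]
    exact Finset.sum_congr rfl fun j _ => by simp [mul_pow]
  rw [norm2, h, Real.sqrt_mul (by positivity), Real.sqrt_sq (by positivity), norm2]

lemma norm2_neg {d : ℕ} (k : Fin d → ℤ) : norm2 (-k) = norm2 k := by
  simp [norm2]

/-- The weighted `ℓ₁`-norm of a real sequence. -/
def weightedNorm {d : ℕ} (s : ℝ) (α : PosFreq d → ℝ) : ℝ≥0∞ :=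
  ∑' k : PosFreq d, ENNReal.ofReal (norm2 k.1 ^ s) * ‖α k‖ₑ

lemma tsum_enorm_le_weightedNorm {d : ℕ} {s : ℝ} (hs : 0 ≤ s) (α : PosFreq d → ℝ) :
    ∑' k, ‖α k‖ₑ ≤ weightedNorm s α := by
  refine ENNReal.tsum_le_tsum fun k => le_mul_of_one_le_left zero_le ?_
  rw [ENNReal.one_le_ofReal]
  exact Real.one_le_rpow (one_le_norm2 k.ne_zero) hs

lemma summable_norm_of_tsum_enorm_ne_top {ι : Type} {α : ι → ℝ} (h : ∑' k, ‖α k‖ₑ ≠ ∞) :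
    Summable fun k => |α k| := by
  have := ENNReal.summable_toReal h
  simpa using this

/-- The positive multiple `m k` of a frequency. -/
def mulFreq {d : ℕ} (p : PosFreq d × ℕ+) : PosFreq d :=
  ⟨(p.2 : ℕ) • p.1.1, by
    obtain ⟨⟨k, j, h1, h2⟩, m⟩ := p
    refine ⟨j, fun i hi => by simp [h1 i hi], ?_⟩
    simpa using h2⟩

lemma freqDot_mulFreq {d : ℕ} (p : PosFreq d × ℕ+) (x : Fin d → ℝ) :
    freqDot (mulFreq p).1 x = (p.2 : ℕ) * freqDot p.1.1 x :=
  freqDot_nsmul _ _ _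

/-- The constant in the change of basis between trigonometric and piecewise linear systems. -/
def basisConst (s : ℝ) : ℝ≥0∞ := ∑' m : ℕ+, ENNReal.ofReal (2 / (m : ℝ) ^ 2 * (m : ℝ) ^ s)

lemma basisConst_ne_top {s : ℝ} (hs : s < 1) : basisConst s ≠ ∞ := by
  have h : Summable fun m : ℕ+ => 2 / (m : ℝ) ^ 2 * (m : ℝ) ^ s := by
    have h1 : Summable fun n : ℕ => 2 * (n : ℝ) ^ (s - 2) :=
      (Real.summable_nat_rpow.mpr (by linarith)).mul_left 2
    refine (h1.comp_injective PNat.coe_injective).congr fun m => ?_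
    have hm : (0 : ℝ) < m := by exact_mod_cast m.pos
    simp only [Function.comp]
    rw [Real.rpow_sub hm, Real.rpow_two]
    ring
  exact h.tsum_ofReal_ne_top

/-- Inserting the series for φ gives an absolutely convergent double series over (k, m), which is
regrouped by the product frequency mk. The weight is multiplicative along m, so the norm bound
factors into `basisConst s` times the old norm. -/
lemma exists_basis_change {d : ℕ} {s : ℝ} (hs0 : 0 ≤ s) {φ ψ : ℝ → ℝ}
    (hψ : ∀ t, |ψ t| ≤ 1) {l : ℕ+ → ℝ} (hl : ∀ m, |l m| ≤ 2 / (m : ℝ) ^ 2)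
    (hsum : ∀ t, HasSum (fun m => l m * ψ (m * t)) (φ t)) (A : PosFreq d → ℝ)
    (hA : weightedNorm s A ≠ ∞) :
    ∃ α : PosFreq d → ℝ, weightedNorm s α ≤ basisConst s * weightedNorm s A ∧
      ∀ x, HasSum (fun k => α k * ψ (freqDot k.1 x)) (∑' k : PosFreq d, A k * φ (freqDot k.1 x)) := by
  refine ⟨fun k => ∑' p : mulFreq ⁻¹' {k}, A p.1.1 * l p.1.2, ?_, fun x => ?_⟩
  · calc weightedNorm s (fun k => ∑' p : mulFreq ⁻¹' {k}, A p.1.1 * l p.1.2)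
        ≤ ∑' k : PosFreq d, ∑' p : mulFreq ⁻¹' {k},
            ENNReal.ofReal (norm2 (mulFreq p.1).1 ^ s) * ‖A p.1.1 * l p.1.2‖ₑ := by
          refine ENNReal.tsum_le_tsum fun k => ?_
          have h1 : ∀ p : mulFreq ⁻¹' {k}, ENNReal.ofReal (norm2 (mulFreq p.1).1 ^ s) *
              ‖A p.1.1 * l p.1.2‖ₑ = ENNReal.ofReal (norm2 k.1 ^ s) * ‖A p.1.1 * l p.1.2‖ₑ := by
            rintro ⟨p, rfl⟩
            rfl
          rw [tsum_congr h1, ENNReal.tsum_mul_left]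
          gcongr
          exact enorm_tsum_le_tsum_enorm
      _ = ∑' p : PosFreq d × ℕ+, ENNReal.ofReal (norm2 (mulFreq p).1 ^ s) * ‖A p.1 * l p.2‖ₑ :=
          ENNReal.tsum_fiberwise
            (fun p => ENNReal.ofReal (norm2 (mulFreq p).1 ^ s) * ‖A p.1 * l p.2‖ₑ) mulFreq
      _ ≤ ∑' p : PosFreq d × ℕ+, ENNReal.ofReal (norm2 p.1.1 ^ s) * ‖A p.1‖ₑ *
            ENNReal.ofReal (2 / (p.2 : ℝ) ^ 2 * (p.2 : ℝ) ^ s) := by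
          refine ENNReal.tsum_le_tsum fun p => ?_
          have h1 : norm2 (mulFreq p).1 ^ s = ((p.2 : ℕ) : ℝ) ^ s * norm2 p.1.1 ^ s := by
            rw [mulFreq, norm2_nsmul, Real.mul_rpow (by positivity) (norm2_nonneg _)]
          have h2 : ‖l p.2‖ₑ ≤ ENNReal.ofReal (2 / (p.2 : ℝ) ^ 2) := by
            rw [← ofReal_norm, Real.norm_eq_abs]
            exact ENNReal.ofReal_le_ofReal (hl _)
          rw [h1, enorm_mul, ENNReal.ofReal_mul (by positivity), ENNReal.ofReal_mul (by positivity)]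
          calc _ = ENNReal.ofReal (norm2 p.1.1 ^ s) * ‖A p.1‖ₑ *
                (‖l p.2‖ₑ * ENNReal.ofReal ((p.2 : ℝ) ^ s)) := by ring
            _ ≤ _ := by gcongr
      _ = basisConst s * weightedNorm s A := by
          rw [ENNReal.tsum_prod (f := fun (k : PosFreq d) (m : ℕ+) =>
            ENNReal.ofReal (norm2 k.1 ^ s) * ‖A k‖ₑ * ENNReal.ofReal (2 / (m : ℝ) ^ 2 * (m : ℝ) ^ s))]
          simp only [ENNReal.tsum_mul_left]
          rw [ENNReal.tsum_mul_right, mul_comm]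
          rfl
  · let G : PosFreq d × ℕ+ → ℝ := fun p => A p.1 * l p.2 * ψ (freqDot (mulFreq p).1 x)
    have hA1 : Summable fun k => |A k| := summable_norm_of_tsum_enorm_ne_top
      (ne_top_of_le_ne_top hA (tsum_enorm_le_weightedNorm hs0 A))
    have hl1 : Summable fun m : ℕ+ => 2 * (1 / (m : ℝ) ^ 2) := summable_one_div_pnat_sq.mul_left 2
    have hG : Summable G := by
      refine Summable.of_norm_bounded (hA1.mul_of_nonneg hl1 (fun _ => abs_nonneg _)
        fun _ => by positivity) fun p => ?_
      rw [Real.norm_eq_abs, abs_mul, abs_mul]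
      calc |A p.1| * |l p.2| * |ψ _| ≤ |A p.1| * |l p.2| * 1 := by
            gcongr
            exact hψ _
        _ = |A p.1| * |l p.2| := mul_one _
        _ ≤ _ := by
            gcongr
            rw [mul_one_div]
            exact hl _
    have h1 := hG.hasSum.tsum_fiberwise mulFreq
    have h2 := hG.hasSum.prod_fiberwise (g := fun k => A k * φ (freqDot k.1 x)) fun k => by
      have := (hsum (freqDot k.1 x)).mul_left (A k)
      convert! this using 2 with m
      simp only [G, freqDot_mulFreq]
      ring
    rw [h2.tsum_eq]
    convert! h1 using 2 with k
    rw [← tsum_mul_right]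
    refine tsum_congr ?_
    rintro ⟨p, rfl⟩
    rfl

lemma PosFreq.neg_ne {d : ℕ} (k l : PosFreq d) : k.1 ≠ -l.1 := fun h =>
  PosFreq.add_ne_zero k l (by rw [h]; simp)

/-- Every integer vector is zero, or plus or minus a positive frequency. -/
def freqEquiv (d : ℕ) : Unit ⊕ (PosFreq d ⊕ PosFreq d) ≃ (Fin d → ℤ) :=
  Equiv.ofBijective (Sum.elim (fun _ => 0) (Sum.elim (fun k => k.1) fun k => -k.1)) <| by
    constructor
    · rintro (_ | k | k) (_ | l | l) h <;> simp only [Sum.elim_inl, Sum.elim_inr] at h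
      · rfl
      · exact absurd h.symm l.ne_zero
      · exact absurd (neg_eq_zero.mp h.symm) l.ne_zero
      · exact absurd h k.ne_zero
      · rw [Subtype.ext h]
      · exact absurd h (PosFreq.neg_ne k l)
      · exact absurd (neg_eq_zero.mp h) k.ne_zero
      · exact absurd h.symm (PosFreq.neg_ne l k)
      · rw [Subtype.ext (neg_injective h)]
    · intro m
      rcases eq_or_ne m 0 with rfl | hm
      · exact ⟨Sum.inl (), rfl⟩
      · obtain ⟨j, h1, h2⟩ := exists_first_pos hm
        rcases lt_or_gt_of_ne h2 with h | h
        · refine ⟨Sum.inr (Sum.inr ⟨-m, j, fun i hi => by simp [h1 i hi], by simpa using h⟩), ?_⟩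
          simp
        · exact ⟨Sum.inr (Sum.inl ⟨m, j, h1, h⟩), rfl⟩

lemma tsum_posFreq_le_barronNorm {d : ℕ} (s : ℝ) (a : (Fin d → ℤ) → ℂ) :
    ∑' k : PosFreq d, ENNReal.ofReal (norm2 k.1 ^ s) * (‖a k.1‖ₑ + ‖a (-k.1)‖ₑ)
      ≤ barronNorm s a := by
  let e : PosFreq d ⊕ PosFreq d → {m : Fin d → ℤ // m ≠ 0} :=
    Sum.elim (fun k => ⟨k.1, k.ne_zero⟩) fun k => ⟨-k.1, neg_ne_zero.mpr k.ne_zero⟩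
  have he : Function.Injective e := by
    intro p q h
    have h1 : freqEquiv d (Sum.inr p) = freqEquiv d (Sum.inr q) := by
      have := congrArg Subtype.val h
      rcases p with p | p <;> rcases q with q | q <;> exact this
    exact Sum.inr_injective ((freqEquiv d).injective h1)
  let g : {m : Fin d → ℤ // m ≠ 0} → ℝ≥0∞ := fun m => ENNReal.ofReal (norm2 m.1 ^ s) * ‖a m.1‖ₑ
  have hs := HasSum.sum (f := g ∘ e) ENNReal.summable.hasSum ENNReal.summable.hasSum
  calc _ = ∑' p, (g ∘ e) p := by
        rw [hs.tsum_eq, ← ENNReal.tsum_add]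
        refine tsum_congr fun k => ?_
        simp only [Function.comp, e, g, Sum.elim_inl, Sum.elim_inr, norm2_neg, mul_add]
    _ ≤ ∑' m, g m := ENNReal.tsum_comp_le_tsum_of_injective he g
    _ ≤ _ := le_add_self

/-- The cosine coefficients of the real part of a Fourier series. -/
def cosCoeff {d : ℕ} (a : (Fin d → ℤ) → ℂ) (k : PosFreq d) : ℝ := (a k.1).re + (a (-k.1)).re

/-- The sine coefficients of the real part of a Fourier series. -/
def sinCoeff {d : ℕ} (a : (Fin d → ℤ) → ℂ) (k : PosFreq d) : ℝ := (a (-k.1)).im - (a k.1).im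

lemma enorm_re_le (z : ℂ) : ‖z.re‖ₑ ≤ ‖z‖ₑ := by
  rw [enorm_le_iff_norm_le]
  exact Complex.abs_re_le_norm z

lemma enorm_im_le (z : ℂ) : ‖z.im‖ₑ ≤ ‖z‖ₑ := by
  rw [enorm_le_iff_norm_le]
  exact Complex.abs_im_le_norm z

lemma weightedNorm_cosCoeff_le {d : ℕ} (s : ℝ) (a : (Fin d → ℤ) → ℂ) :
    weightedNorm s (cosCoeff a) ≤ barronNorm s a := by
  refine le_trans (ENNReal.tsum_le_tsum fun k => ?_) (tsum_posFreq_le_barronNorm s a)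
  gcongr
  exact (enorm_add_le _ _).trans (add_le_add (enorm_re_le _) (enorm_re_le _))

lemma weightedNorm_sinCoeff_le {d : ℕ} (s : ℝ) (a : (Fin d → ℤ) → ℂ) :
    weightedNorm s (sinCoeff a) ≤ barronNorm s a := by
  refine le_trans (ENNReal.tsum_le_tsum fun k => ?_) (tsum_posFreq_le_barronNorm s a)
  gcongr
  rw [add_comm]
  exact enorm_sub_le.trans (add_le_add (enorm_im_le _) (enorm_im_le _))

lemma re_mul_exp (z : ℂ) (t : ℝ) : (z * Complex.exp (2 * Real.pi * Complex.I * (t : ℝ))).re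
    = z.re * Real.cos (2 * Real.pi * t) - z.im * Real.sin (2 * Real.pi * t) := by
  rw [show (2 * Real.pi * Complex.I * (t : ℝ) : ℂ) = ((2 * Real.pi * t : ℝ) : ℂ) * Complex.I by
    push_cast; ring, Complex.mul_re, Complex.exp_ofReal_mul_I_re, Complex.exp_ofReal_mul_I_im]

lemma freqDot_neg {d : ℕ} (k : Fin d → ℤ) (x : Fin d → ℝ) : freqDot (-k) x = -freqDot k x := by
  simp [freqDot]

lemma summable_abs_of_weightedNorm {d : ℕ} {s : ℝ} (hs : 0 ≤ s) {α : PosFreq d → ℝ}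
    (h : weightedNorm s α ≠ ∞) : Summable fun k => |α k| :=
  summable_norm_of_tsum_enorm_ne_top (ne_top_of_le_ne_top h (tsum_enorm_le_weightedNorm hs α))

lemma summable_mul_of_abs_le_one {ι : Type} {α : ι → ℝ} (hα : Summable fun k => |α k|) {u : ι → ℝ}
    (hu : ∀ k, |u k| ≤ 1) : Summable fun k => α k * u k := by
  refine Summable.of_norm_bounded hα fun k => ?_
  rw [Real.norm_eq_abs, abs_mul]
  exact mul_le_of_le_one_right (abs_nonneg _) (hu k)

lemma hasSum_frequencies {d : ℕ} {g : (Fin d → ℤ) → ℝ} {y : ℝ} (h : HasSum g y) :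
    y = g 0 + ∑' k : PosFreq d, (g k.1 + g (-k.1)) := by
  have h1 : HasSum (g ∘ freqEquiv d) y := (freqEquiv d).hasSum_iff.mpr h
  have hp : Summable fun k : PosFreq d => g k.1 := h.summable.comp_injective Subtype.val_injective
  have hn : Summable fun k : PosFreq d => g (-k.1) :=
    h.summable.comp_injective (i := fun k : PosFreq d => -k.1)
      (neg_injective.comp Subtype.val_injective)
  have h0 : HasSum ((g ∘ freqEquiv d) ∘ Sum.inl) (g 0) := hasSum_unique (g ∘ freqEquiv d ∘ Sum.inl)
  have h2 := h0.sum (HasSum.sum (f := (g ∘ freqEquiv d) ∘ Sum.inr) hp.hasSum hn.hasSum)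
  rw [h1.unique h2, hp.tsum_add hn]

/-- Taking real parts and pairing k with -k avoids any appeal to conjugate symmetry of the
coefficients. -/
lemma eq_cos_sin_of_hasSum {d : ℕ} {s : ℝ} (hs : 0 ≤ s) {a : (Fin d → ℤ) → ℂ}
    (ha : barronNorm s a ≠ ∞) {x : Fin d → ℝ} {y : ℝ}
    (h : HasSum (fun m : Fin d → ℤ =>
      a m * Complex.exp (2 * (Real.pi : ℂ) * Complex.I * ((freqDot m x : ℝ) : ℂ))) (y : ℂ)) :
    y = (a 0).re + (∑' k, cosCoeff a k * Real.cos (2 * Real.pi * freqDot k.1 x)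
      + ∑' k, sinCoeff a k * Real.sin (2 * Real.pi * freqDot k.1 x)) := by
  have hre := Complex.hasSum_re h
  simp only [re_mul_exp, Complex.ofReal_re] at hre
  rw [hasSum_frequencies hre]
  have hc := summable_mul_of_abs_le_one (summable_abs_of_weightedNorm hs
    (ne_top_of_le_ne_top ha (weightedNorm_cosCoeff_le s a)))
    (u := fun k => Real.cos (2 * Real.pi * freqDot k.1 x)) fun _ => Real.abs_cos_le_one _
  have hsn := summable_mul_of_abs_le_one (summable_abs_of_weightedNorm hs
    (ne_top_of_le_ne_top ha (weightedNorm_sinCoeff_le s a)))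
    (u := fun k => Real.sin (2 * Real.pi * freqDot k.1 x)) fun _ => Real.abs_sin_le_one _
  congr 1
  · simp [freqDot]
  · rw [← hc.tsum_add hsn]
    refine tsum_congr fun k => ?_
    simp only [freqDot_neg, cosCoeff, sinCoeff, mul_neg, Real.cos_neg, Real.sin_neg]
    ring

/-- Expansion of a Barron function in the piecewise linear system. -/
lemma IsBarron.exists_expansion {d : ℕ} {s : ℝ} (hs0 : 0 ≤ s)
    {f : (Fin d → ℝ) → ℝ} {a : (Fin d → ℤ) → ℂ} (h : IsBarron s f a) :
    ∃ (α₀ : ℝ) (α β : PosFreq d → ℝ),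
      weightedNorm s α ≤ basisConst s * barronNorm s a ∧
      weightedNorm s β ≤ basisConst s * barronNorm s a ∧
      ∀ᵐ x ∂volume.restrict (cube d),
        HasSum (fun k => α k * plCosAt k.1 x + β k * plSinAt k.1 x) (f x - α₀) := by
  obtain ⟨hf, ha⟩ := h
  obtain ⟨l, hl, hl'⟩ := exists_hasSum_plCos
  obtain ⟨l₂, hl₂, hl₂'⟩ := exists_hasSum_plSin
  obtain ⟨α, hα, hα'⟩ := exists_basis_change hs0 abs_plCos_le hl hl' (cosCoeff a)
    (ne_top_of_le_ne_top ha.ne (weightedNorm_cosCoeff_le s a))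
  obtain ⟨β, hβ, hβ'⟩ := exists_basis_change hs0
    (fun t => by rw [plSin_eq_plCos]; exact abs_plCos_le _) hl₂ hl₂' (sinCoeff a)
    (ne_top_of_le_ne_top ha.ne (weightedNorm_sinCoeff_le s a))
  refine ⟨(a 0).re, α, β, hα.trans ?_, hβ.trans ?_, ?_⟩
  · gcongr
    exact weightedNorm_cosCoeff_le s a
  · gcongr
    exact weightedNorm_sinCoeff_le s a
  · filter_upwards [hf] with x hx
    rw [eq_cos_sin_of_hasSum hs0 ha.ne hx, add_sub_cancel_left]
    exact (hα' x).add (hβ' x)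

lemma abs_add_plTerm_le {d : ℕ} (α β : PosFreq d → ℝ) (k : PosFreq d) (x : Fin d → ℝ) :
    |α k * plCosAt k.1 x + β k * plSinAt k.1 x| ≤ |α k| + |β k| := by
  have h1 : |plCosAt k.1 x| ≤ 1 := abs_plCos_le _
  have h2 : |plSinAt k.1 x| ≤ 1 := by
    rw [plSinAt, plSin_eq_plCos]
    exact abs_plCos_le _
  refine (abs_add_le _ _).trans ?_
  rw [abs_mul, abs_mul]
  exact add_le_add (mul_le_of_le_one_right (abs_nonneg _) h1)
    (mul_le_of_le_one_right (abs_nonneg _) h2)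

lemma continuous_plSum {d : ℕ} (α₀ : ℝ) (α β : PosFreq d → ℝ) (F : Finset (PosFreq d)) :
    Continuous fun x => α₀ + ∑ k ∈ F, (α k * plCosAt k.1 x + β k * plSinAt k.1 x) := by
  have hc : ∀ k : PosFreq d, Continuous (plCosAt k.1) := fun k =>
    continuous_plCos.comp (continuous_freqDot k.1)
  have hs : ∀ k : PosFreq d, Continuous (plSinAt k.1) := fun k =>
    continuous_plSin.comp (continuous_freqDot k.1)
  fun_prop

/-- The remainder is bounded almost everywhere by a tail of ∑ (|α_k| + |β_k|), and the cube has
measure one. -/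
lemma hasPLSeries_of_ae_hasSum {d : ℕ} {f : (Fin d → ℝ) → ℝ} {α₀ : ℝ} {α β : PosFreq d → ℝ}
    (hα : Summable fun k => |α k|) (hβ : Summable fun k => |β k|)
    (h : ∀ᵐ x ∂volume.restrict (cube d),
      HasSum (fun k => α k * plCosAt k.1 x + β k * plSinAt k.1 x) (f x - α₀)) :
    HasPLSeries f α₀ α β := by
  have hsum : Summable fun k => |α k| + |β k| := hα.add hβ
  have ht : Tendsto (fun F : Finset (PosFreq d) =>
      ENNReal.ofReal (∑' k : {k // k ∉ F}, (|α k| + |β k|))) atTop (𝓝 0) := by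
    have := tendsto_tsum_compl_atTop_zero fun k => |α k| + |β k|
    simpa using ENNReal.tendsto_ofReal this
  refine tendsto_of_tendsto_of_tendsto_of_le_of_le tendsto_const_nhds ht (fun _ => zero_le) fun F => ?_
  have hb : ∀ᵐ x ∂volume.restrict (cube d),
      ‖f x - (α₀ + ∑ k ∈ F, (α k * plCosAt k.1 x + β k * plSinAt k.1 x))‖
        ≤ ∑' k : {k // k ∉ F}, (|α k| + |β k|) := by
    filter_upwards [h] with x hx
    have h1 := hx.summable.sum_add_tsum_subtype_compl F
    rw [hx.tsum_eq] at h1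
    rw [show f x - (α₀ + ∑ k ∈ F, (α k * plCosAt k.1 x + β k * plSinAt k.1 x))
      = ∑' k : {k // k ∉ F}, (α k * plCosAt k.1.1 x + β k * plSinAt k.1.1 x) by linarith]
    exact tsum_of_norm_bounded (hsum.subtype _).hasSum fun k => abs_add_plTerm_le α β k x
  simpa using eLpNorm_le_of_ae_bound hb

lemma aestronglyMeasurable_of_ae_hasSum {d : ℕ} {f : (Fin d → ℝ) → ℝ} {α₀ : ℝ}
    {α β : PosFreq d → ℝ}
    (h : ∀ᵐ x ∂volume.restrict (cube d),
      HasSum (fun k => α k * plCosAt k.1 x + β k * plSinAt k.1 x) (f x - α₀)) :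
    AEStronglyMeasurable f (volume.restrict (cube d)) := by
  refine aestronglyMeasurable_of_tendsto_ae atTop
    (f := fun (F : Finset (PosFreq d)) x =>
      α₀ + ∑ k ∈ F, (α k * plCosAt k.1 x + β k * plSinAt k.1 x))
    (fun F => (continuous_plSum α₀ α β F).aestronglyMeasurable) ?_
  filter_upwards [h] with x hx
  simpa using hx.const_add α₀

/-! ### Networks for sparse coefficient sequences -/

/-- Short frequencies get two neurons each. If there is a long one, then half of the terms is
dropped and the others get four neurons each. -/
lemma exists_reluNet_of_sparse {d n J : ℕ} [Nonempty (PosFreq d)] (hd : 1 ≤ d) {R s : ℝ}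
    (hR : 1 ≤ R) (hn : R < d → R ^ (2 * s) ≤ 2 * n)
    (hJ : 2 * (R * Real.sqrt (min R (d : ℝ))) ≤ 2 ^ J) (α₀ : ℝ) (α β : PosFreq d → ℝ)
    (S S' : Finset (PosFreq d)) (hS : S.card ≤ n) (hS' : S'.card ≤ n)
    (hSR : ∀ k ∈ S, norm2 k.1 ≤ R) (hSR' : ∀ k ∈ S', norm2 k.1 ≤ R) :
    ∃ (N : ReLUNet d (4 * n) (J + 1)) (I I' : Finset (PosFreq d)), I ⊆ S ∧ I' ⊆ S' ∧
      (∀ x ∈ cube d, N.eval x =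
        α₀ + ∑ k ∈ I, α k * plCosAt k.1 x + ∑ k ∈ I', β k * plSinAt k.1 x) ∧
      ((∀ k ∈ S ∪ S', norm1 k.1 ≤ R * Real.sqrt (min R (d : ℝ))) → I = S ∧ I' = S') ∧
      R ^ (2 * s) * ∑ k ∈ S \ I, α k ^ 2 ≤ 4 * (∑ k ∈ S, |α k|) ^ 2 ∧
      R ^ (2 * s) * ∑ k ∈ S' \ I', β k ^ 2 ≤ 4 * (∑ k ∈ S', |β k|) ^ 2 := by
  have hd' : (1 : ℝ) ≤ d := by exact_mod_cast hd
  have hR0 : 0 < R := by linarith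
  set T := R * Real.sqrt (min R (d : ℝ)) with hT
  by_cases hshort : ∀ k ∈ S ∪ S', norm1 k.1 ≤ T
  · have hT1 : 1 ≤ T := by
      have : 1 ≤ Real.sqrt (min R (d : ℝ)) := Real.one_le_sqrt.mpr (le_min hR hd')
      exact one_le_mul_of_one_le_of_one_le hR this
    obtain ⟨N, hN⟩ := exists_reluNet_plSum (w := 2) (L := J + 1) (M := 2 * n) (J := J)
      (by omega) (by ring : 2 * n * 2 = 4 * n) ![2, -4] ![0, 1 / 2]
      (fun y hy => tent_iterate_succ J hy) α₀ α β S S' (by omega)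
      (fun k hk => by linarith [hshort k (Finset.mem_union_left _ hk)])
      (fun k hk => by linarith [hshort k (Finset.mem_union_right _ hk)])
    refine ⟨N, S, S', subset_rfl, subset_rfl, hN, fun _ => ⟨rfl, rfl⟩, ?_, ?_⟩ <;>
    · rw [Finset.sdiff_self, Finset.sum_empty, mul_zero]
      positivity
  -- For d ≤ R, Cauchy–Schwarz makes every frequency short, so a long one forces R < d and the lower
  -- bound on n becomes available.
  · have hRd : R < d := by
      by_contra! hdR
      refine hshort fun k hk => ?_
      have hk2 : norm2 k.1 ≤ R := (Finset.mem_union.mp hk).elim (hSR k) (hSR' k)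
      rw [hT, min_eq_right hdR, mul_comm]
      exact (norm1_le_sqrt_mul_norm2 k.1).trans (by gcongr)
    have hm : R ^ (2 * s) ≤ 4 * (((n / 2 : ℕ) : ℝ) + 1) := by
      have h1 : n ≤ 2 * (n / 2 + 1) := by omega
      have h2 : (n : ℝ) ≤ 2 * (((n / 2 : ℕ) : ℝ) + 1) := by exact_mod_cast h1
      linarith [hn hRd]
    have htail : ∀ {t A : ℝ}, t ≤ A ^ 2 / (((n / 2 : ℕ) : ℝ) + 1) → R ^ (2 * s) * t ≤ 4 * A ^ 2 := by
      intro t A h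
      have hm0 : (0 : ℝ) < ((n / 2 : ℕ) : ℝ) + 1 := by positivity
      calc R ^ (2 * s) * t ≤ R ^ (2 * s) * (A ^ 2 / (((n / 2 : ℕ) : ℝ) + 1)) := by gcongr
        _ ≤ 4 * (((n / 2 : ℕ) : ℝ) + 1) * (A ^ 2 / (((n / 2 : ℕ) : ℝ) + 1)) := by gcongr
        _ = 4 * A ^ 2 := by field_simp
    obtain ⟨I, hI, hIc, hIt⟩ := exists_subset_sum_sq_le S α (n / 2)
    obtain ⟨I', hI', hIc', hItail⟩ := exists_subset_sum_sq_le S' β (n / 2)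
    -- J + 1 layers of double tents are 2J + 2 tents, hence frequency 2^(2J+1) = 2 (2^J)² ≥ 2R² ≥ R²
    -- + 1.
    have hlen : ∀ k : PosFreq d, norm2 k.1 ≤ R → norm1 k.1 + 1 ≤ 2 ^ (2 * J + 1) := by
      intro k hk
      have h1 : norm1 k.1 ≤ R ^ 2 := (norm1_le_norm2_sq k.1).trans
        (pow_le_pow_left₀ (norm2_nonneg _) hk 2)
      have h2 : R ≤ 2 ^ J := by
        have h3 : 1 ≤ Real.sqrt (min R (d : ℝ)) := Real.one_le_sqrt.mpr (le_min hR hd')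
        have : R ≤ T := le_mul_of_one_le_right hR0.le h3
        linarith
      have h4 : R ^ 2 ≤ (2 ^ J) ^ 2 := pow_le_pow_left₀ hR0.le h2 2
      have h5 : (2 : ℝ) ^ (2 * J + 1) = 2 * (2 ^ J) ^ 2 := by rw [pow_succ, mul_comm 2 J, pow_mul]; ring
      have h6 : 1 ≤ R ^ 2 := one_le_pow₀ hR
      rw [h5]
      linarith
    obtain ⟨N, hN⟩ := exists_reluNet_plSum (w := 4) (L := J + 1) (M := n) (J := 2 * J + 1)
      (by omega) (by ring : n * 4 = 4 * n) ![4, -8, 8, -8] ![0, 1 / 4, 1 / 2, 3 / 4]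
      (fun y hy => by
        change 1 - 2 * doubleTent^[J + 1] y = _
        rw [doubleTent_iterate _ hy]
        exact tent_iterate_succ (2 * J + 1) hy) α₀ α β I I' (by omega)
      (fun k hk => hlen k (hSR k (hI hk))) (fun k hk => hlen k (hSR' k (hI' hk)))
    exact ⟨N, I, I', hI, hI', hN, fun h => absurd h hshort, htail hIt, htail hItail⟩

/-! ### Error bounds -/

lemma sum_weight_le {d : ℕ} {s b : ℝ} (hb : 0 ≤ b) {α : PosFreq d → ℝ}
    (h : weightedNorm s α ≤ ENNReal.ofReal b) (F : Finset (PosFreq d)) :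
    ∑ k ∈ F, norm2 k.1 ^ s * |α k| ≤ b := by
  have h1 := (ENNReal.sum_le_tsum F).trans h
  have h2 : ∀ k : PosFreq d, 0 ≤ norm2 k.1 ^ s * |α k| := fun k =>
    mul_nonneg (Real.rpow_nonneg (norm2_nonneg _) _) (abs_nonneg _)
  rw [← ENNReal.ofReal_le_ofReal_iff hb, ENNReal.ofReal_sum_of_nonneg fun k _ => h2 k]
  refine le_trans (le_of_eq (Finset.sum_congr rfl fun k _ => ?_)) h1
  rw [ENNReal.ofReal_mul (Real.rpow_nonneg (norm2_nonneg _) _), ← Real.norm_eq_abs, ofReal_norm]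

lemma sum_abs_le {d : ℕ} {s b : ℝ} (hs : 0 ≤ s) (hb : 0 ≤ b) {α : PosFreq d → ℝ}
    (h : weightedNorm s α ≤ ENNReal.ofReal b) (F : Finset (PosFreq d)) : ∑ k ∈ F, |α k| ≤ b :=
  (Finset.sum_le_sum fun k _ => le_mul_of_one_le_left (abs_nonneg _)
    (Real.one_le_rpow (one_le_norm2 k.ne_zero) hs)).trans (sum_weight_le hb h F)

/-- Beyond R every weight is at least R^s, so the ℓ₁-norm of the tail is at most b/R^s, and it
dominates the ℓ₂-norm. -/
lemma sum_sq_sub_truncate_le {d : ℕ} {s b R : ℝ} (hs : 0 ≤ s) (hb : 0 ≤ b) (hR : 0 < R)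
    {α : PosFreq d → ℝ} (h : weightedNorm s α ≤ ENNReal.ofReal b) (F : Finset (PosFreq d)) :
    ∑ k ∈ F, (α k - truncate R α k) ^ 2 ≤ (b / R ^ s) ^ 2 := by
  have h1 : ∑ k ∈ F, |α k - truncate R α k| ≤ b / R ^ s := by
    rw [le_div_iff₀ (by positivity), Finset.sum_mul]
    refine (Finset.sum_le_sum fun k _ => ?_).trans (sum_weight_le hb h F)
    by_cases hk : norm2 k.1 ≤ R
    · simp only [truncate, Set.indicator_of_mem (show k ∈ {k : PosFreq d | norm2 k.1 ≤ R} from hk),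
        sub_self, abs_zero, zero_mul]
      exact mul_nonneg (Real.rpow_nonneg (norm2_nonneg _) _) (abs_nonneg _)
    · simp only [truncate, Set.indicator_of_notMem (show k ∉ {k : PosFreq d | norm2 k.1 ≤ R} from hk),
        sub_zero]
      rw [mul_comm]
      gcongr
      exact (not_le.mp hk).le
  refine le_trans ?_ (pow_le_pow_left₀ (Finset.sum_nonneg fun _ _ => abs_nonneg _) h1 2)
  have := Finset.sum_sq_le_sq_sum_of_nonneg (s := F) (f := fun k => |α k - truncate R α k|)
    fun _ _ => abs_nonneg _
  simpa using this

lemma weightedNorm_truncate_le {d : ℕ} (s R : ℝ) (α : PosFreq d → ℝ) :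
    bNorm s (fun k => (truncate R α k : ℂ)) ≤ weightedNorm s α := by
  refine ENNReal.tsum_le_tsum fun k => ?_
  gcongr
  rw [enorm_le_iff_norm_le, Complex.norm_real]
  exact norm_indicator_le_norm_self _ _

lemma finite_support_truncate {d : ℕ} (R : ℝ) (α : PosFreq d → ℝ) :
    (Function.support (truncate R α)).Finite :=
  (finite_norm2_le R).subset Set.support_indicator_subset

lemma tsum_truncate_ne_top {d : ℕ} (R : ℝ) (α : PosFreq d → ℝ) :
    ∑' k, ‖truncate R α k‖ₑ ^ 2 ≠ ∞ := by
  rw [tsum_eq_sum (s := (finite_support_truncate R α).toFinset) fun k hk => by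
    have : truncate R α k = 0 := by simpa using hk
    simp [this]]
  simp [ENNReal.sum_eq_top]

lemma sum_sq_sub_isBest_le {d n : ℕ} [Nonempty (PosFreq d)] {s b R t : ℝ} (hs : 0 ≤ s)
    (hb : 0 ≤ b) (ht : 0 ≤ t) {α α' : PosFreq d → ℝ} (h : weightedNorm s α ≤ ENNReal.ofReal b)
    (hσ : sigmaN d s n ≤ ENNReal.ofReal t) (hα' : IsBestNTerm n (truncate R α) α')
    (F : Finset (PosFreq d)) :
    ∑ k ∈ F, (truncate R α k - α' k) ^ 2 ≤ (b * t) ^ 2 := by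
  have h1 : ell2Norm (truncate R α - α') ≤ ENNReal.ofReal (b * t) := by
    rw [hα'.2, ENNReal.ofReal_mul hb]
    have hw := (weightedNorm_truncate_le s R α).trans h
    exact (nTermError_le_ofReal n _).trans ((nTermError_le_bNorm_mul_sigmaN hs n _
      (ne_top_of_le_ne_top ENNReal.ofReal_ne_top hw)).trans (mul_le_mul' hw hσ))
  have h2 : ∑ k ∈ F, ‖(truncate R α - α') k‖ₑ ^ 2 ≤ ENNReal.ofReal (b * t) ^ 2 := by
    refine (ENNReal.sum_le_tsum F).trans ?_
    rw [← ell2Norm_sq]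
    exact pow_le_pow_left' h1 2
  rw [← ENNReal.ofReal_le_ofReal_iff (by positivity), ENNReal.ofReal_sum_of_nonneg
    fun k _ => sq_nonneg _, ENNReal.ofReal_pow (by positivity)]
  refine le_trans (le_of_eq (Finset.sum_congr rfl fun k _ => ?_)) h2
  rw [← sq_abs, ENNReal.ofReal_pow (abs_nonneg _), ← Real.norm_eq_abs, ofReal_norm, Pi.sub_apply]

/-- The `ℓ₂`-error after truncation, best `n`-term approximation and dropping of terms. -/
lemma sum_sq_sub_indicator_le {d n : ℕ} [Nonempty (PosFreq d)] {s b R t : ℝ} (hs : 0 ≤ s)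
    (hb : 0 ≤ b) (hR : 0 < R) (ht : 0 ≤ t) {α α' : PosFreq d → ℝ}
    (h : weightedNorm s α ≤ ENNReal.ofReal b)
    (hσ : sigmaN d s n ≤ ENNReal.ofReal t) (hα' : IsBestNTerm n (truncate R α) α')
    {S I : Finset (PosFreq d)} (hS : (S : Set (PosFreq d)) = Function.support α')
    (hI : R ^ (2 * s) * ∑ k ∈ S \ I, α' k ^ 2 ≤ 4 * (∑ k ∈ S, |α' k|) ^ 2)
    (F : Finset (PosFreq d)) :
    ∑ k ∈ F, (α k - Set.indicator (I : Set (PosFreq d)) α' k) ^ 2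
      ≤ b ^ 2 * (5 / (R ^ s) ^ 2 + t ^ 2) := by
  obtain ⟨K, -, hK⟩ := hα'.exists_eq_indicator (tsum_truncate_ne_top R α)
  have hval : ∀ k, α' k = 0 ∨ (α' k = truncate R α k ∧ truncate R α k = α k) := by
    intro k
    rw [hK]
    by_cases hk : k ∈ K
    · by_cases hk' : k ∈ {k : PosFreq d | norm2 k.1 ≤ R}
      · right
        simp only [Set.indicator_of_mem (Finset.mem_coe.mpr hk), truncate,
          Set.indicator_of_mem hk', and_self]
      · left
        simp only [Set.indicator_of_mem (Finset.mem_coe.mpr hk), truncate,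
          Set.indicator_of_notMem hk']
    · left
      simp [hk]
  have htr : ∀ k, truncate R α k = 0 ∨ truncate R α k = α k := fun k =>
    Set.indicator_eq_zero_or_self _ _ _
  -- Each stage keeps an entry or sets it to zero, so the three errors have disjoint supports and
  -- their squares add. The 5 in the bound is 1 from truncation plus 4 from the dropped terms.
  have hpt : ∀ k, (α k - Set.indicator (I : Set (PosFreq d)) α' k) ^ 2 =
      (α k - truncate R α k) ^ 2 + (truncate R α k - α' k) ^ 2
        + (α' k - Set.indicator (I : Set (PosFreq d)) α' k) ^ 2 := by
    intro k
    by_cases hk : k ∈ I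
    · rw [Set.indicator_of_mem (Finset.mem_coe.mpr hk)]
      rcases hval k with h1 | ⟨h1, h2⟩
      · rcases htr k with h2 | h2 <;> rw [h1, h2] <;> ring
      · rw [h1, h2]; ring
    · rw [Set.indicator_of_notMem (by simpa using hk)]
      rcases hval k with h1 | ⟨h1, h2⟩
      · rcases htr k with h2 | h2 <;> rw [h1, h2] <;> ring
      · rw [h1, h2]; ring
  have hA : ∑ k ∈ S, |α' k| ≤ b := by
    refine (Finset.sum_le_sum fun k _ => ?_).trans (sum_abs_le hs hb h S)
    rcases hval k with h1 | ⟨h1, h2⟩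
    · simp [h1]
    · rw [h1, h2]
  have hRs : (R ^ s) ^ 2 = R ^ (2 * s) := by
    rw [← Real.rpow_natCast, ← Real.rpow_mul hR.le, mul_comm]
    norm_num
  have h3 : ∑ k ∈ F, (α' k - Set.indicator (I : Set (PosFreq d)) α' k) ^ 2
      ≤ 4 * b ^ 2 / (R ^ s) ^ 2 := by
    have h4 : ∑ k ∈ F, (α' k - Set.indicator (I : Set (PosFreq d)) α' k) ^ 2
        ≤ ∑ k ∈ S \ I, α' k ^ 2 := by
      have h5 : ∀ k, k ∉ S \ I → (α' k - Set.indicator (I : Set (PosFreq d)) α' k) ^ 2 = 0 := by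
        intro k hk
        by_cases hkI : k ∈ I
        · simp [hkI]
        · have : k ∉ (S : Set (PosFreq d)) := fun h' => hk (Finset.mem_sdiff.mpr ⟨h', hkI⟩)
          rw [hS, Function.notMem_support] at this
          simp [hkI, this]
      calc _ ≤ ∑ k ∈ F ∪ S \ I, (α' k - Set.indicator (I : Set (PosFreq d)) α' k) ^ 2 :=
            Finset.sum_le_sum_of_subset_of_nonneg Finset.subset_union_left fun _ _ _ => sq_nonneg _
        _ = ∑ k ∈ S \ I, (α' k - Set.indicator (I : Set (PosFreq d)) α' k) ^ 2 :=
            (Finset.sum_subset Finset.subset_union_right fun k _ hk => h5 k hk).symm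
        _ = _ := Finset.sum_congr rfl fun k hk => by simp [(Finset.mem_sdiff.mp hk).2]
    rw [le_div_iff₀ (by positivity), hRs]
    have h6 : (∑ k ∈ S, |α' k|) ^ 2 ≤ b ^ 2 :=
      pow_le_pow_left₀ (Finset.sum_nonneg fun _ _ => abs_nonneg _) hA 2
    have h7 := mul_le_mul_of_nonneg_left h4 (show 0 ≤ R ^ (2 * s) by positivity)
    linarith
  have h1 := sum_sq_sub_truncate_le hs hb hR h F
  have h2 := sum_sq_sub_isBest_le hs hb ht h hσ hα' F
  simp only [hpt, Finset.sum_add_distrib]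
  calc _ ≤ (b / R ^ s) ^ 2 + (b * t) ^ 2 + 4 * b ^ 2 / (R ^ s) ^ 2 := by linarith
    _ = _ := by ring

/-- For finite F ⊇ I ∪ J the difference is a series remainder plus a cosine and a sine sum, each of
these two of norm at most D; the remainder vanishes in the limit over F. -/
lemma eLpNorm_sub_le_of_hasPLSeries {d : ℕ} {f g : (Fin d → ℝ) → ℝ} {α₀ D : ℝ}
    {α β α' β' : PosFreq d → ℝ} {I J : Finset (PosFreq d)}
    (hf : AEStronglyMeasurable f (volume.restrict (cube d))) (h : HasPLSeries f α₀ α β)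
    (hg : ∀ x ∈ cube d, g x =
      α₀ + ∑ k ∈ I, α' k * plCosAt k.1 x + ∑ k ∈ J, β' k * plSinAt k.1 x) (hD : 0 ≤ D)
    (hα : ∀ F : Finset (PosFreq d),
      ∑ k ∈ F, (α k - Set.indicator (I : Set (PosFreq d)) α' k) ^ 2 ≤ D ^ 2)
    (hβ : ∀ F : Finset (PosFreq d),
      ∑ k ∈ F, (β k - Set.indicator (J : Set (PosFreq d)) β' k) ^ 2 ≤ D ^ 2) :
    eLpNorm (fun x => f x - g x) 2 (volume.restrict (cube d)) ≤ ENNReal.ofReal (2 * D) := by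
  have hc := fun k : PosFreq d => continuous_freqDot k.1
  have hpc := continuous_plCos
  have hlim := h.add_const (ENNReal.ofReal D + ENNReal.ofReal D)
  rw [zero_add, ← ENNReal.ofReal_add hD hD, ← two_mul] at hlim
  refine ge_of_tendsto hlim ?_
  filter_upwards [eventually_ge_atTop (I ∪ J)] with F hF
  have hIF : I ⊆ F := Finset.union_subset_left hF
  have hJF : J ⊆ F := Finset.union_subset_right hF
  let u : (Fin d → ℝ) → ℝ := fun x =>
    f x - (α₀ + ∑ k ∈ F, (α k * plCosAt k.1 x + β k * plSinAt k.1 x))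
  let v : (Fin d → ℝ) → ℝ := fun x =>
    ∑ k ∈ F, (α k - Set.indicator (I : Set (PosFreq d)) α' k) * plCos (freqDot k.1 x + 0)
  let w : (Fin d → ℝ) → ℝ := fun x =>
    ∑ k ∈ F, (β k - Set.indicator (J : Set (PosFreq d)) β' k) * plCos (freqDot k.1 x + 3 / 4)
  have hv : Continuous v := by fun_prop
  have hw : Continuous w := by fun_prop
  have hu : AEStronglyMeasurable u (volume.restrict (cube d)) :=
    hf.sub (continuous_plSum α₀ α β F).aestronglyMeasurable
  have heq : (fun x => f x - g x) =ᵐ[volume.restrict (cube d)] u + (v + w) := by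
    filter_upwards [ae_restrict_mem measurableSet_Icc] with x hx
    have h1 : ∀ (I : Finset (PosFreq d)) (a ψ : PosFreq d → ℝ), I ⊆ F →
        ∑ k ∈ I, a k * ψ k = ∑ k ∈ F, Set.indicator (I : Set (PosFreq d)) a k * ψ k := by
      intro I a ψ hI
      rw [← Finset.sum_subset hI fun k _ hk => by simp [hk]]
      exact Finset.sum_congr rfl fun k hk => by simp [hk]
    rw [hg x hx, h1 I α' _ hIF, h1 J β' _ hJF]
    simp only [Pi.add_apply, u, v, w, sub_mul, Finset.sum_add_distrib, Finset.sum_sub_distrib,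
      plCosAt, plSinAt, plSin_eq_plCos, add_zero]
    ring
  rw [eLpNorm_congr_ae heq, two_mul, ENNReal.ofReal_add hD hD]
  refine (eLpNorm_add_le hu (hv.add hw).aestronglyMeasurable (by norm_num)).trans ?_
  gcongr
  refine (eLpNorm_add_le hv.aestronglyMeasurable hw.aestronglyMeasurable (by norm_num)).trans ?_
  exact add_le_add (eLpNorm_sum_plCos_le _ F _ hD (hα F)) (eLpNorm_sum_plCos_le _ F _ hD (hβ F))

/-! ### The choice of parameters -/

/-- If 2n < R^(2s), then 2n ≤ d² and the flat sequence gives 1/(6√n) < 1/(5R^s), so R^(2s) < (36/25)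
n, a contradiction. -/
lemma rpow_le_two_mul_of_sigmaN_lt {d n : ℕ} {s R : ℝ} (hs1 : s < 1) (hn : 1 ≤ n)
    (hR : 1 ≤ R) (hRd : R < d) (hσ : sigmaN d s n < ENNReal.ofReal (1 / (5 * R ^ s))) :
    R ^ (2 * s) ≤ 2 * n := by
  by_contra! hlt
  have hR0 : 0 < R := by linarith
  have hnd : 2 * n ≤ d ^ 2 := by
    have h1 : R ^ (2 * s) ≤ R ^ 2 := by
      rw [← Real.rpow_two]
      exact Real.rpow_le_rpow_of_exponent_le hR (by linarith)
    have h2 : R ^ 2 ≤ (d : ℝ) ^ 2 := pow_le_pow_left₀ hR0.le hRd.le 2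
    have h3 : (2 * n : ℝ) ≤ (d : ℝ) ^ 2 := by linarith
    exact_mod_cast h3
  have h1 := (ofReal_le_sigmaN hs1.le hn hnd).trans_lt hσ
  have hRs : 0 < R ^ s := by positivity
  have hn0 : 0 < Real.sqrt n := Real.sqrt_pos.mpr (by exact_mod_cast hn)
  rw [ENNReal.ofReal_lt_ofReal_iff (by positivity), inv_eq_one_div,
    one_div_lt_one_div (by positivity) (by positivity)] at h1
  have h2 : R ^ (2 * s) = (R ^ s) ^ 2 := by
    rw [← Real.rpow_natCast, ← Real.rpow_mul hR0.le, mul_comm]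
    norm_num
  have h3 := Real.sq_sqrt (show (0 : ℝ) ≤ n by positivity)
  have h4 : (R ^ s) ^ 2 < (6 / 5 * Real.sqrt n) ^ 2 :=
    pow_lt_pow_left₀ (by linarith) hRs.le two_ne_zero
  rw [h2] at hlt
  nlinarith

/-- The factor 2 provides for ‖k‖₁ + 1 ≤ T + 1 ≤ 2T. -/
lemma exists_depth {T : ℝ} (hT : 1 ≤ T) :
    ∃ J : ℕ, 2 * T ≤ 2 ^ J ∧ ((J + 1 : ℕ) : ℝ) ≤ 4 + Real.logb 2 T := by
  have hT0 : 0 < T := by linarith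
  have hlog : 0 ≤ Real.logb 2 T := Real.logb_nonneg one_lt_two hT
  refine ⟨⌈Real.logb 2 T⌉₊ + 1, ?_, ?_⟩
  · rw [pow_succ, mul_comm]
    gcongr
    rw [← Real.rpow_natCast, ← Real.logb_le_iff_le_rpow one_lt_two hT0]
    exact Nat.le_ceil _
  · have := Nat.ceil_lt_add_one hlog
    push_cast
    linarith

lemma IsBestNTerm.exists_support_finset {d n : ℕ} [Nonempty (PosFreq d)] {R : ℝ}
    {α α' : PosFreq d → ℝ} (h : IsBestNTerm n (truncate R α) α') :
    ∃ S : Finset (PosFreq d), (S : Set (PosFreq d)) = Function.support α' ∧ S.card ≤ n ∧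
      ∀ k ∈ S, norm2 k.1 ≤ R := by
  classical
  obtain ⟨K, hK, rfl⟩ := h.exists_eq_indicator (tsum_truncate_ne_top R α)
  refine ⟨K.filter fun k => truncate R α k ≠ 0, ?_, (Finset.card_filter_le _ _).trans hK, ?_⟩
  · ext k
    simp
  · intro k hk
    by_contra hR
    exact (Finset.mem_filter.mp hk).2
      (Set.indicator_of_notMem (show k ∉ {k : PosFreq d | norm2 k.1 ≤ R} from hR) α)

end

end BarronANN

/-! ### Choice of the constants and assembly of the error estimate -/

theorem mainTheorem4 (s : ℝ) (hs0 : 0 < s) (hs1 : s < 1) :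
    ∃ c C : ℝ, 0 < c ∧ 0 < C ∧
      ∀ (d : ℕ), 1 ≤ d → ∀ ε : ℝ, 0 < ε → ε < 1 →
      ∀ R : ℝ, R = (C / ε) ^ (1 / s) →
      ∀ n : ℕ, 1 ≤ n → sigmaN d s n < ENNReal.ofReal (c * ε) →
      ∃ L : ℕ, 1 ≤ L ∧ (L : ℝ) ≤ 4 + Real.logb 2 (R * Real.sqrt (min R (d : ℝ))) ∧
      -- the network is a function of the coefficients of best n-term approximations
      ∃ net : ℝ → (PosFreq d → ℝ) → (PosFreq d → ℝ) → ReLUNet d (4 * n) L,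
      ∀ (f : (Fin d → ℝ) → ℝ) (a : (Fin d → ℤ) → ℂ), IsBarron s f a →
      ∃ (α₀ : ℝ) (α β : PosFreq d → ℝ), HasPLSeries f α₀ α β ∧
        (∃ α' : PosFreq d → ℝ, IsBestNTerm n (truncate R α) α') ∧
        (∃ β' : PosFreq d → ℝ, IsBestNTerm n (truncate R β) β') ∧
        ∀ α' β' : PosFreq d → ℝ,
          IsBestNTerm n (truncate R α) α' → IsBestNTerm n (truncate R β) β' →
          eLpNorm (fun x => f x - (net α₀ α' β').eval x) 2 (volume.restrict (cube d))
              ≤ ENNReal.ofReal ε * barronNorm s a ∧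
          ∃ I J : Finset (PosFreq d),
            (I : Set (PosFreq d)) ⊆ Function.support α' ∧
            (J : Set (PosFreq d)) ⊆ Function.support β' ∧
            (∀ x ∈ cube d, (net α₀ α' β').eval x =
              α₀ + ∑ k ∈ I, α' k * plCosAt k.1 x + ∑ k ∈ J, β' k * plSinAt k.1 x) ∧
            ((∀ k ∈ Function.support α' ∪ Function.support β',
                norm1 k.1 ≤ R * Real.sqrt (min R (d : ℝ))) →
              (I : Set (PosFreq d)) = Function.support α' ∧
              (J : Set (PosFreq d)) = Function.support β') := by
  set K : ℝ := (basisConst s).toReal + 1 with hK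
  have hK1 : 1 ≤ K := by
    have : 0 ≤ (basisConst s).toReal := ENNReal.toReal_nonneg
    linarith
  have hK0 : 0 < K := by linarith
  -- With C = 6K one has R^s = 6K/ε, and c = 1/(30K) makes cε equal to 1/(5R^s), the threshold in
  -- `rpow_le_two_mul_of_sigmaN_lt`.
  refine ⟨1 / (30 * K), 6 * K, by positivity, by positivity, ?_⟩
  intro d hd ε hε0 hε1 R hR n hn hσ
  have := nonempty_posFreq hd
  have hRs : R ^ s = 6 * K / ε := by
    rw [hR, ← Real.rpow_mul (by positivity), one_div_mul_cancel hs0.ne', Real.rpow_one]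
  have hR1 : 1 ≤ R := by
    rw [hR]
    refine Real.one_le_rpow ?_ (by positivity)
    rw [one_le_div hε0]
    linarith
  have hR0 : 0 < R := by linarith
  have hsparse : R < d → R ^ (2 * s) ≤ 2 * n := fun hRd =>
    rpow_le_two_mul_of_sigmaN_lt hs1 hn hR1 hRd (by
      convert hσ using 2
      rw [hRs]
      field_simp
      norm_num)
  have hT1 : 1 ≤ R * Real.sqrt (min R (d : ℝ)) :=
    one_le_mul_of_one_le_of_one_le hR1
      (Real.one_le_sqrt.mpr (le_min hR1 (by exact_mod_cast hd)))
  obtain ⟨J, hJ, hL⟩ := exists_depth hT1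
  refine ⟨J + 1, by omega, hL, ?_⟩
  -- The network may depend only on α₀ and the two sparse sequences, so it is chosen before f. Their
  -- supports determine S and S'; inputs without suitable supports receive the zero network.
  have hnet : ∀ (α₀ : ℝ) (α β : PosFreq d → ℝ), ∃ N : ReLUNet d (4 * n) (J + 1),
      ∀ S S' : Finset (PosFreq d), (S : Set (PosFreq d)) = Function.support α →
        (S' : Set (PosFreq d)) = Function.support β → S.card ≤ n → S'.card ≤ n →
        (∀ k ∈ S, norm2 k.1 ≤ R) → (∀ k ∈ S', norm2 k.1 ≤ R) →
        ∃ I I' : Finset (PosFreq d), I ⊆ S ∧ I' ⊆ S' ∧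
          (∀ x ∈ cube d, N.eval x =
            α₀ + ∑ k ∈ I, α k * plCosAt k.1 x + ∑ k ∈ I', β k * plSinAt k.1 x) ∧
          ((∀ k ∈ S ∪ S', norm1 k.1 ≤ R * Real.sqrt (min R (d : ℝ))) → I = S ∧ I' = S') ∧
          R ^ (2 * s) * ∑ k ∈ S \ I, α k ^ 2 ≤ 4 * (∑ k ∈ S, |α k|) ^ 2 ∧
          R ^ (2 * s) * ∑ k ∈ S' \ I', β k ^ 2 ≤ 4 * (∑ k ∈ S', |β k|) ^ 2 := by
    intro α₀ α β
    by_cases h : ∃ S S' : Finset (PosFreq d), (S : Set (PosFreq d)) = Function.support α ∧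
        (S' : Set (PosFreq d)) = Function.support β ∧ S.card ≤ n ∧ S'.card ≤ n ∧
        (∀ k ∈ S, norm2 k.1 ≤ R) ∧ (∀ k ∈ S', norm2 k.1 ≤ R)
    · obtain ⟨S, S', h1, h2, h3, h4, h5, h6⟩ := h
      obtain ⟨N, hN⟩ := exists_reluNet_of_sparse hd hR1 hsparse hJ α₀ α β S S' h3 h4 h5 h6
      refine ⟨N, fun T T' hT hT' _ _ _ _ => ?_⟩
      obtain rfl : S = T := Finset.coe_injective (h1.trans hT.symm)
      obtain rfl : S' = T' := Finset.coe_injective (h2.trans hT'.symm)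
      exact hN
    · exact ⟨⟨0, fun _ => 0, 0⟩, fun S S' h1 h2 h3 h4 h5 h6 =>
        absurd ⟨S, S', h1, h2, h3, h4, h5, h6⟩ h⟩
  choose net hnet using hnet
  refine ⟨net, fun f a hf => ?_⟩
  obtain ⟨α₀, α, β, hα, hβ, hsum⟩ := hf.exists_expansion hs0.le
  set ν : ℝ := (barronNorm s a).toReal with hν
  have hν0 : 0 ≤ ν := ENNReal.toReal_nonneg
  have hνe : ENNReal.ofReal ν = barronNorm s a := ENNReal.ofReal_toReal hf.2.ne
  have hB : basisConst s * barronNorm s a ≤ ENNReal.ofReal (K * ν) := by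
    rw [ENNReal.ofReal_mul hK0.le, hνe]
    gcongr
    rw [← ENNReal.ofReal_toReal (basisConst_ne_top hs1)]
    exact ENNReal.ofReal_le_ofReal (by linarith)
  have hKν : 0 ≤ K * ν := by positivity
  have hα' := hα.trans hB
  have hβ' := hβ.trans hB
  have hseries : HasPLSeries f α₀ α β := hasPLSeries_of_ae_hasSum
    (summable_abs_of_weightedNorm hs0.le (ne_top_of_le_ne_top ENNReal.ofReal_ne_top hα'))
    (summable_abs_of_weightedNorm hs0.le (ne_top_of_le_ne_top ENNReal.ofReal_ne_top hβ')) hsum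
  refine ⟨α₀, α, β, hseries, exists_isBestNTerm n _ (finite_support_truncate R α),
    exists_isBestNTerm n _ (finite_support_truncate R β), fun α' β' hbα hbβ => ?_⟩
  obtain ⟨S, hS, hSc, hSR⟩ := hbα.exists_support_finset
  obtain ⟨S', hS', hSc', hSR'⟩ := hbβ.exists_support_finset
  obtain ⟨I, I', hI, hI', heval, hfull, htail, htail'⟩ :=
    hnet α₀ α' β' S S' hS hS' hSc hSc' hSR hSR'
  -- Here 5/36 + 1/900 < 1/4, so the cosine and the sine parts contribute at most half of the
  -- allowed error each.
  have hD : (K * ν) ^ 2 * (5 / (R ^ s) ^ 2 + (1 / (30 * K) * ε) ^ 2) ≤ (ε / 2 * ν) ^ 2 := by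
    have : (K * ν) ^ 2 * (5 / (R ^ s) ^ 2 + (1 / (30 * K) * ε) ^ 2)
        = (5 / 36 + 1 / 900) * (ε * ν) ^ 2 := by
      rw [hRs]
      field_simp
      ring
    rw [this]
    nlinarith [sq_nonneg (ε * ν)]
  have hc0 : 0 ≤ 1 / (30 * K) * ε := by positivity
  refine ⟨?_, I, I', ?_, ?_, heval, fun hshort => ?_⟩
  · refine (eLpNorm_sub_le_of_hasPLSeries (D := ε / 2 * ν) (aestronglyMeasurable_of_ae_hasSum hsum)
      hseries heval (by positivity)
      (fun F => (sum_sq_sub_indicator_le hs0.le hKν hR0 hc0 hα' hσ.le hbα hS htail F).trans hD)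
      fun F => (sum_sq_sub_indicator_le hs0.le hKν hR0 hc0 hβ' hσ.le hbβ hS' htail' F).trans hD).trans
      (le_of_eq ?_)
    rw [← hνe, ← ENNReal.ofReal_mul hε0.le]
    congr 1
    ring
  · rw [← hS]
    exact_mod_cast hI
  · rw [← hS']
    exact_mod_cast hI'
  · obtain ⟨rfl, rfl⟩ := hfull fun k hk => hshort k (by
      rw [← hS, ← hS']
      simpa using hk)
    exact ⟨hS, hS'⟩
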